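/- There is a function $\delta:\mathbb{N}\to\mathbb{R}$ with $\delta(n)\to 0$ as $n\to\infty$ such that the following holds. Let $n,d,s,t,m\in\mathbb{N}$ with $s\ge 1$, $n\ge d^2$, $tm=d$, $2\le t\le\sqrt{\frac{\log d}{10\log\log d}}$ and $s\le\min\bigl(n^{\frac{d}{1100t^2}},\,2^{\,n^{1/(30t^2)}}\bigr)$, where $\log=\log_2$. Let $\mathbb{F}$ be a field with $\operatorname{char}\mathbb{F}=0$ or $\operatorname{char}\mathbb{F}>2d$, let $S\subseteq\mathbb{F}$ be a finite set with $|S|\ge(ns)^{150t}$, and let $c_1,\dots,c_s\in\mathbb{F}\setminus\{0\}$. Let $Q_1,\dots,Q_s\in\mathbb{F}[x_1,\dots,x_n]$ be random homogeneous polynomials of degree $t$ whose coefficients (one for each $i\in\{1,\dots,s\}$ and each monomial of degree $t$ in $x_1,\dots,x_n$) are chosen independently and uniformly at random from $S$. Then with probability at least $1-\delta(n)$ the circuit $f=c_1Q_1^m+\dots+c_sQ_s^m$ is non-degenerate in the following sense. Put $n_0=\lfloor n^{1/(3t)}\rfloor$, $m_0=\lfloor n^{1/(15t^2)}\rfloor$,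 $k=\bigl\lceil\frac{130\,t\log s}{\log n}\bigr\rceil$, $e=m-k$, $\mathbf{z}=(z_1,\dots,z_{n_0})$, $\mathbf{w}=(w_1,\dots,w_{m_0})$. For a tuple $L$ of polynomials let $\pi_L$ denote the substitution of the entries of $L$ for the variables, let $\partial^k g$ be the set of all partial derivatives of order $k$ of $g$, and let $\langle\cdot\rangle$ be the $\mathbb{F}$-linear span. The circuit is non-degenerate if there exist a tuple $L$ of $n$ linear forms in $\mathbb{F}[\mathbf{z}]$ and a tuple $P$ of $n_0$ linear forms in $\mathbb{F}[\mathbf{w}]$ such that, with $G_i=\pi_L(Q_i)$ and $g_0=G_1^e+\dots+G_s^e$: 1. $U=U_1\oplus\dots\oplus U_s$ and $\dim U_i=\binom{n_0+k(t-1)-1}{k(t-1)}$ for all $i$, where $U=\langle\pi_L(\partial_{\mathbf{x}}^k f)\rangle$ and $U_i=\langle\pi_L(\partial_{\mathbf{x}}^k Q_i^m)\rangle$; 2. $W=W_1\oplus\dots\oplus W_s$ and $\dim W_i=\binom{m_0+k(t-1)-1}{k(t-1)}$ for all $i$, where $W=\langle\pi_P(\partial_{\mathbf{z}}^k g_0)\rangle$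 and $W_i=\langle\pi_P(\partial_{\mathbf{z}}^k G_i^e)\rangle$; 3. the sum $\widetilde U_1+\dots+\widetilde U_s$ is direct, where $\widetilde U_i$ is the span of all products $\mu\, G_i^e$ with $\mu$ a $\mathbf{z}$-monomial of degree $2k(t-1)$; 4. the polynomials $[G_1^e]_{z_1=0},\dots,[G_s^e]_{z_1=0}$ are $\mathbb{F}$-linearly independent. -/

import Mathlib

noncomputable section

namespace PowerSums

open MvPolynomial

/-- The number `n₀ = ⌊n^{1/(3t)}⌋` of `z`-variables. -/
def zVars (n t : ℕ) : ℕ := ⌊(n : ℝ) ^ ((1 : ℝ) / (3 * (t : ℝ)))⌋₊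

/-- The number `m₀ = ⌊n^{1/(15t²)}⌋` of `w`-variables. -/
def wVars (n t : ℕ) : ℕ := ⌊(n : ℝ) ^ ((1 : ℝ) / (15 * (t : ℝ) ^ 2))⌋₊

/-- The order `k = ⌈130 t log s / log n⌉` of the derivatives (the quotient of the two logarithms
does not depend on their base). -/
def derOrder (n s t : ℕ) : ℕ := ⌈130 * (t : ℝ) * Real.logb 2 (s : ℝ) / Real.logb 2 (n : ℝ)⌉₊

/-- The set `∂^k f` of all partial derivatives of `f` of order `k`: differentiate successively
with respect to the members of a list of `k` variables (repetitions allowed). -/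
def partials {σ F : Type*} [Field F] (k : ℕ) (f : MvPolynomial σ F) : Set (MvPolynomial σ F) :=
  {g | ∃ l : List σ, l.length = k ∧ g = l.foldr (fun i h => pderiv i h) f}

/-- A tuple of linear forms, i.e. of homogeneous polynomials of degree one (or zero polynomials). -/
def IsLinearTuple {σ τ F : Type*} [Field F] (L : σ → MvPolynomial τ F) : Prop :=
  ∀ i, (L i).IsHomogeneous 1

/-- The projection `π_L`, which substitutes `L i` for the `i`-th variable. -/
def proj {σ τ F : Type*} [Field F] (L : σ → MvPolynomial τ F) :
    MvPolynomial σ F →ₐ[F] MvPolynomial τ F :=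
  aeval L

/-- The space `⟨π_L(∂^k f)⟩` spanned by the projections of the partial derivatives of order `k`. -/
def app {σ τ F : Type*} [Field F] (L : σ → MvPolynomial τ F) (k : ℕ) (f : MvPolynomial σ F) :
    Submodule F (MvPolynomial τ F) :=
  Submodule.span F (proj L '' partials k f)

/-- The space `⟨z^r · g⟩` spanned by the products of `g` with the monomials of degree `r`. -/
def shifts {τ F : Type*} [Field F] (r : ℕ) (g : MvPolynomial τ F) :
    Submodule F (MvPolynomial τ F) :=
  Submodule.span F {h | ∃ β : τ →₀ ℕ, β.degree = r ∧ h = monomial β (1 : F) * g}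

/-- `U = U₁ ⊕ ⋯ ⊕ U_s`, an internal direct sum of subspaces. -/
def IsDirectSum {ι F V : Type*} [Field F] [AddCommGroup V] [Module F V]
    (U : Submodule F V) (Ui : ι → Submodule F V) : Prop :=
  U = ⨆ i, Ui i ∧ iSupIndep Ui

/-- The substitution `z₁ = 0` (the first variable has index `0`). -/
def killFirst {N : ℕ} {F : Type*} [Field F] :
    MvPolynomial (Fin N) F →ₐ[F] MvPolynomial (Fin N) F :=
  aeval fun j : Fin N => if j.val = 0 then 0 else X j

/-- The circuit `c₁ Q₁^m + ⋯ + c_s Q_s^m` in `n` variables, where the `Q_i` are homogeneous of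
degree `t`, is non-degenerate. -/
def IsNonDegenerate {F : Type*} [Field F] (n s t m : ℕ) (c : Fin s → F)
    (Q : Fin s → MvPolynomial (Fin n) F) : Prop :=
  let n₀ := zVars n t
  let m₀ := wVars n t
  let k := derOrder n s t
  let e := m - k
  let f := ∑ i, C (c i) * Q i ^ m
  ∃ (L : Fin n → MvPolynomial (Fin n₀) F) (P : Fin n₀ → MvPolynomial (Fin m₀) F),
    IsLinearTuple L ∧ IsLinearTuple P ∧
    let G := fun i => proj L (Q i)
    let g₀ := ∑ i, G i ^ e
    (IsDirectSum (app L k f) (fun i => app L k (Q i ^ m)) ∧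
      ∀ i, Module.finrank F (app L k (Q i ^ m)) =
        (n₀ + k * (t - 1) - 1).choose (k * (t - 1))) ∧
    (IsDirectSum (app P k g₀) (fun i => app P k (G i ^ e)) ∧
      ∀ i, Module.finrank F (app P k (G i ^ e)) =
        (m₀ + k * (t - 1) - 1).choose (k * (t - 1))) ∧
    iSupIndep (fun i => shifts (2 * k * (t - 1)) (G i ^ e)) ∧
    LinearIndependent F (fun i => killFirst (G i ^ e))

/-- The exponent vectors of the monomials of degree `t` in `n` variables. -/
abbrev Mon (n t : ℕ) : Type :=
  ↥(Finset.finsuppAntidiag (Finset.univ : Finset (Fin n)) t)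

/-- The homogeneous polynomial of degree `t` with prescribed coefficients. -/
def form {F : Type*} [Field F] {n t : ℕ} (a : Mon n t → F) : MvPolynomial (Fin n) F :=
  ∑ α : Mon n t, monomial α.1 (a α)

/-- The probability of the event `E` under the uniform distribution on a finite sample space. On a
space of functions `I → S` this is the distribution of a family, indexed by `I`, of independent
uniformly random elements of `S`. -/
def uniformProb {Ω : Type*} [Finite Ω] (E : Ω → Prop) : ℝ :=
  (Nat.card {ω // E ω} : ℝ) / (Nat.card Ω : ℝ)

end PowerSums

end

/-! Each of the four conditions follows from the linear independence of a finite family of vectors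
depending polynomially on the coefficients of the `Q_i`. If such a family is independent for one
choice of coefficients, then it stays so off the zero set of a nonzero determinant of bounded degree
(`exists_polynomial_linearIndependent`), and Schwartz–Zippel bounds the bad probability. A product
of four nonzero polynomials is nonzero, so each condition may have its own witness; `L` and `P` are
always restrictions to the first variables.

For conditions 1 and 2, a derivative of order `k` of `Q ^ m` is a form of degree `k(t-1)` times `Q ^
(m - k)`. This bounds each summand by the number of monomials, and enough independent vectors in the
total space then force a direct sum of full dimension (`isDirectSum_of_linearIndependent`).

The witnesses start from `G_i = ℓ_i ^ t`, where `ℓ_i` is the sum of the variables selected by a word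
of a Reed–Solomon code. Repeated differentiation in the variables of `ℓ_i` annihilates `p * ℓ_j ^ D`
for `j ≠ i` and is injective on the products `p * ℓ_i ^ D` (`linearIndependent_shifted_powers`).
This settles conditions 3 and 4. For 1 and 2, terms linear in fresh variables are added to `G_i`, so
that suitable derivatives isolate one summand and yield any prescribed monomial times a power of
`G_i` (`exists_linearIndependent_listDeriv`).

The remaining work is arithmetic at the scale `X = n^{1/(30t²)}`: the parameters fit, and the
failure probability is at most `1/n`. -/

namespace PowerSums

open MvPolynomial

/-! ### Schwartz–Zippel and generic linear independence. -/

section Generic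

/-- Schwartz–Zippel for doubly indexed families of values in a finite set. -/
theorem card_eval_eq_zero_mul_card_le {ι κ F : Type*} [Field F] [Fintype ι] [Fintype κ]
    (p : MvPolynomial (ι × κ) F) (hp : p ≠ 0) (S : Finset F) (hS : S.Nonempty) :
    (Nat.card {a : ι → κ → S // eval (fun x => (a x.1 x.2 : F)) p = 0} : ℝ) * S.card ≤
      p.totalDegree * Nat.card (ι → κ → S) := by
  classical
  have hcard : Nat.card (ι → κ → S) = S.card ^ Fintype.card (ι × κ) := by
    simp [Nat.card_eq_fintype_card, ← pow_mul, mul_comm]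
  rw [hcard]
  have e : ι × κ ≃ Fin (Fintype.card (ι × κ)) := Fintype.equivFin _
  generalize Fintype.card (ι × κ) = N at e
  have hq : rename e p ≠ 0 := fun h => hp ((rename_injective e e.injective) (by simpa using h))
  have hsz := schwartz_zippel_totalDegree hq S
  have hdeg : (rename e p).totalDegree = p.totalDegree := totalDegree_renameEquiv e p
  rw [hdeg] at hsz
  set Z := (Fintype.piFinset fun _ : Fin N => S).filter (fun f => eval f (rename e p) = 0) with hZ
  have hinj : Nat.card {a : ι → κ → S // eval (fun x => (a x.1 x.2 : F)) p = 0} ≤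
      Nat.card {f // f ∈ Z} := by
    refine Nat.card_le_card_of_injective
      (fun a => ⟨fun j => (a.1 (e.symm j).1 (e.symm j).2 : F), ?_⟩) ?_
    · rw [hZ, Finset.mem_filter, Fintype.mem_piFinset]
      refine ⟨fun j => (a.1 _ _).2, ?_⟩
      rw [eval_rename]
      have ha := a.2
      have : (fun x : ι × κ => (a.1 x.1 x.2 : F)) =
          (fun j => (a.1 (e.symm j).1 (e.symm j).2 : F)) ∘ e := by
        ext x
        simp
      rwa [this] at ha
    · rintro ⟨a, ha⟩ ⟨b, hb⟩ hab
      rw [Subtype.mk.injEq] at hab ⊢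
      ext i j
      simpa using congrFun hab (e (i, j))
  have hS' : (0 : ℝ) < S.card := by exact_mod_cast hS.card_pos
  rw [Nat.card_eq_fintype_card (α := {f // f ∈ Z}), Fintype.card_coe] at hinj
  have hsz' : (Z.card : ℝ) / (S.card : ℝ) ^ N ≤ (p.totalDegree : ℝ) / S.card := by
    have := (NNRat.cast_le (K := ℝ)).2 hsz
    push_cast at this
    exact this
  rw [div_le_div_iff₀ (by positivity) hS'] at hsz'
  push_cast
  refine le_trans ?_ hsz'
  gcongr

/-- The functions of `a : ι → F` with values in `V` which are polynomial in `a` of degree at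
most `D`. -/
def polyFun (ι F V : Type*) [Field F] [AddCommGroup V] [Module F V] (D : ℕ) :
    Submodule F ((ι → F) → V) :=
  Submodule.span F {v | ∃ (p : MvPolynomial ι F) (w : V), p.totalDegree ≤ D ∧
    v = fun a => eval a p • w}

variable {ι F V W : Type*} [Field F] [AddCommGroup V] [Module F V] [AddCommGroup W] [Module F W]

theorem smul_mem_polyFun {D : ℕ} (p : MvPolynomial ι F) (hp : p.totalDegree ≤ D) (w : V) :
    (fun a => eval a p • w) ∈ polyFun ι F V D :=
  Submodule.subset_span ⟨p, w, hp, rfl⟩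

theorem const_mem_polyFun (D : ℕ) (w : V) : (fun _ => w) ∈ polyFun ι F V D := by
  simpa using smul_mem_polyFun (ι := ι) (F := F) (D := D) 1 (by simp) w

theorem map_mem_polyFun {D : ℕ} (T : V →ₗ[F] W) {v : (ι → F) → V} (hv : v ∈ polyFun ι F V D) :
    (fun a => T (v a)) ∈ polyFun ι F W D := by
  induction hv using Submodule.span_induction with
  | mem v h =>
    obtain ⟨p, w, hp, rfl⟩ := h
    simpa using smul_mem_polyFun p hp (T w)
  | zero => simpa using const_mem_polyFun (ι := ι) (F := F) D (0 : W)
  | add v w _ _ hv hw =>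
    simp only [Pi.add_apply, map_add]
    exact Submodule.add_mem _ hv hw
  | smul c v _ hv =>
    simp only [Pi.smul_apply, map_smul]
    exact Submodule.smul_mem _ c hv

theorem mul_mem_polyFun {A : Type*} [CommRing A] [Algebra F A] {D E : ℕ} {v w : (ι → F) → A}
    (hv : v ∈ polyFun ι F A D) (hw : w ∈ polyFun ι F A E) :
    (fun a => v a * w a) ∈ polyFun ι F A (D + E) := by
  induction hv using Submodule.span_induction with
  | mem v h =>
    obtain ⟨p, x, hp, rfl⟩ := h
    induction hw using Submodule.span_induction with
    | mem w h =>
      obtain ⟨q, y, hq, rfl⟩ := h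
      convert smul_mem_polyFun (p * q) ((totalDegree_mul p q).trans (add_le_add hp hq)) (x * y)
        using 2
      simp [smul_smul, mul_comm]
    | zero => simpa using const_mem_polyFun (ι := ι) (F := F) (D + E) (0 : A)
    | add v w _ _ hv hw =>
      simp only [Pi.add_apply, mul_add]
      exact Submodule.add_mem _ hv hw
    | smul c v _ hv =>
      simp only [Pi.smul_apply, mul_smul_comm]
      exact Submodule.smul_mem _ c hv
  | zero => simpa using const_mem_polyFun (ι := ι) (F := F) (D + E) (0 : A)
  | add v w _ _ hv hw =>
    simp only [Pi.add_apply, add_mul]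
    exact Submodule.add_mem _ hv hw
  | smul c v _ hv =>
    simp only [Pi.smul_apply, smul_mul_assoc]
    exact Submodule.smul_mem _ c hv

theorem pow_mem_polyFun {A : Type*} [CommRing A] [Algebra F A] {D : ℕ} {v : (ι → F) → A}
    (hv : v ∈ polyFun ι F A D) (E : ℕ) : (fun a => v a ^ E) ∈ polyFun ι F A (D * E) := by
  induction E with
  | zero => simpa using const_mem_polyFun (ι := ι) (F := F) 0 (1 : A)
  | succ E ih => simpa [pow_succ, Nat.mul_succ] using mul_mem_polyFun ih hv

theorem sum_mem_polyFun {κ : Type*} {D : ℕ} (s : Finset κ) {v : κ → (ι → F) → V}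
    (hv : ∀ i ∈ s, v i ∈ polyFun ι F V D) : (fun a => ∑ i ∈ s, v i a) ∈ polyFun ι F V D := by
  convert Submodule.sum_mem _ hv
  simp

theorem polyFun_mono {D E : ℕ} (h : D ≤ E) : polyFun ι F V D ≤ polyFun ι F V E :=
  Submodule.span_mono fun _ ⟨p, w, hp, hv⟩ => ⟨p, w, hp.trans h, hv⟩

theorem exists_eval_eq {D : ℕ} {v : (ι → F) → F} (hv : v ∈ polyFun ι F F D) :
    ∃ p : MvPolynomial ι F, p.totalDegree ≤ D ∧ ∀ a, eval a p = v a := by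
  induction hv using Submodule.span_induction with
  | mem v h =>
    obtain ⟨p, w, hp, rfl⟩ := h
    refine ⟨w • p, (totalDegree_smul_le _ _).trans hp, fun a => by simp [mul_comm]⟩
  | zero => exact ⟨0, by simp, by simp⟩
  | add v w _ _ hv hw =>
    obtain ⟨p, hp, hpv⟩ := hv
    obtain ⟨q, hq, hqv⟩ := hw
    exact ⟨p + q, (totalDegree_add p q).trans (max_le hp hq), by simp [hpv, hqv]⟩
  | smul c v _ hv =>
    obtain ⟨p, hp, hpv⟩ := hv
    exact ⟨c • p, (totalDegree_smul_le _ _).trans hp, by simp [hpv]⟩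

/-- A finite family of vectors depending polynomially on `a` which is linearly independent for one
value of `a` is so outside of the zero set of a nonzero polynomial of bounded degree. -/
theorem exists_polynomial_linearIndependent {J : Type*} [Fintype J] {D : ℕ}
    (v : J → (ι → F) → V) (hv : ∀ j, v j ∈ polyFun ι F V D) (a₀ : ι → F)
    (h₀ : LinearIndependent F (fun j => v j a₀)) :
    ∃ p : MvPolynomial ι F, p ≠ 0 ∧ p.totalDegree ≤ Fintype.card J * D ∧
      ∀ a, eval a p ≠ 0 → LinearIndependent F (fun j => v j a) := by
  classical
  -- `T` reads off coordinates with respect to the family at `a₀`, so the matrix of the `T (v j a)`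
  -- is the identity at `a₀`; its determinant is the required polynomial.
  obtain ⟨T, hT⟩ := LinearMap.exists_leftInverse_of_injective
    (Fintype.linearCombination F (fun j => v j a₀))
    (LinearMap.ker_eq_bot.2 h₀.fintypeLinearCombination_injective)
  have hT' : ∀ j, T (v j a₀) = Pi.single j 1 := fun j => by
    simpa [Fintype.linearCombination_apply_single] using LinearMap.congr_fun hT (Pi.single j 1)
  have hentry : ∀ i j, ∃ p : MvPolynomial ι F, p.totalDegree ≤ D ∧ ∀ a, eval a p = T (v j a) i :=
    fun i j => exists_eval_eq (map_mem_polyFun (LinearMap.proj i ∘ₗ T) (hv j))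
  choose M hM hMe using hentry
  have hdet : ∀ a, eval a (Matrix.of M).det = (Matrix.of fun i j => T (v j a) i).det := fun a => by
    rw [RingHom.map_det]
    congr 1
    ext i j
    simp [hMe]
  refine ⟨(Matrix.of M).det, ?_, ?_, fun a ha => ?_⟩
  · intro h
    have h1 := hdet a₀
    have h2 : (Matrix.of fun i j => T (v j a₀) i) = 1 := by
      ext i j
      simp [hT', Matrix.one_apply, Pi.single_apply]
    simp [h, h2] at h1
  · rw [Matrix.det_apply]
    refine totalDegree_finsetSum_le fun σ _ => ?_
    refine (totalDegree_smul_le _ _).trans ((totalDegree_finsetProd _ _).trans ?_)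
    refine (Finset.sum_le_card_nsmul _ _ D fun i _ => hM _ _).trans ?_
    simp
  · rw [hdet] at ha
    refine LinearIndependent.of_comp T ?_
    have := Matrix.linearIndependent_cols_of_det_ne_zero ha
    exact this

end Generic


/-! ### Direct sums by counting dimensions. -/

section Spans

variable {ι κ F V : Type*} [Field F] [AddCommGroup V] [Module F V]

theorem iSupIndep_span_range {w : ι × κ → V} (hw : LinearIndependent F w) :
    iSupIndep fun i => Submodule.span F (Set.range fun k => w (i, k)) := by
  rw [iSupIndep_def]
  intro i
  have h := hw.disjoint_span_image (s := {x | x.1 = i}) (t := {x | x.1 ≠ i})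
    (Set.disjoint_left.2 fun x h1 h2 => h2 h1)
  refine h.mono (Submodule.span_mono ?_) (iSup₂_le fun j hj => Submodule.span_mono ?_)
  · rintro _ ⟨k, rfl⟩
    exact ⟨(i, k), rfl, rfl⟩
  · rintro _ ⟨k, rfl⟩
    exact ⟨(j, k), hj, rfl⟩

/-- If `Uᵢ ≤ Tᵢ` with `Tᵢ` independent and both families have the same supremum, they agree. -/
theorem eq_of_le_of_iSup_eq {U T : ι → Submodule F V} (hT : iSupIndep T) (h : ∀ i, U i ≤ T i)
    (hsup : ⨆ i, T i ≤ ⨆ i, U i) (i : ι) : U i = T i := by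
  refine le_antisymm (h i) fun x hx => ?_
  have hx' : x ∈ U i ⊔ ⨆ (j) (_ : j ≠ i), U j := by
    refine (?_ : ⨆ i, U i ≤ _) (hsup (Submodule.mem_iSup_of_mem i hx))
    refine iSup_le fun j => ?_
    by_cases hj : j = i
    · rw [hj]; exact le_sup_left
    · exact le_sup_of_le_right (le_iSup₂_of_le j hj le_rfl)
  obtain ⟨y, hy, z, hz, rfl⟩ := Submodule.mem_sup.1 hx'
  have hz1 : z ∈ T i := by simpa using Submodule.sub_mem _ hx (h i hy)
  have hz2 : z ∈ ⨆ (j) (_ : j ≠ i), T j := (iSup₂_mono fun j _ => h j) hz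
  rw [Submodule.disjoint_def.1 (hT i) z hz1 hz2, add_zero]
  exact hy

/-- A dimension count: if `U ≤ ∑ Uᵢ`, each `Uᵢ` lies in the span of `|κ|` vectors and `U` contains
`|ι| |κ|` linearly independent vectors, then `U` is the direct sum of the `Uᵢ`, of dimension `|κ|`
each. -/
theorem isDirectSum_of_linearIndependent [Fintype ι] [Fintype κ] {U : Submodule F V}
    {Ui : ι → Submodule F V} {v w : ι × κ → V} (hv : LinearIndependent F v) (hvU : ∀ x, v x ∈ U)
    (hU : U ≤ ⨆ i, Ui i)
    (hUi : ∀ i, Ui i ≤ Submodule.span F (Set.range fun k => w (i, k))) :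
    IsDirectSum U Ui ∧ ∀ i, Module.finrank F (Ui i) = Fintype.card κ := by
  set T : ι → Submodule F V := fun i => Submodule.span F (Set.range fun k => w (i, k)) with hTdef
  have hTle : ∀ i, T i ≤ Submodule.span F (Set.range w) := fun i =>
    Submodule.span_mono (by rintro _ ⟨k, rfl⟩; exact ⟨(i, k), rfl⟩)
  have hUiT : ⨆ i, Ui i ≤ Submodule.span F (Set.range w) :=
    iSup_le fun i => (hUi i).trans (hTle i)
  have hfin : FiniteDimensional F (Submodule.span F (Set.range w)) :=
    FiniteDimensional.span_of_finite F (Set.finite_range w)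
  have hspan : Submodule.span F (Set.range v) ≤ U :=
    Submodule.span_le.2 (by rintro _ ⟨x, rfl⟩; exact hvU x)
  have hcard : Module.finrank F (Submodule.span F (Set.range v)) = Fintype.card (ι × κ) :=
    finrank_span_eq_card hv
  have hle : Submodule.span F (Set.range v) ≤ Submodule.span F (Set.range w) :=
    hspan.trans (hU.trans hUiT)
  -- The span of `w` has dimension at most `|ι × κ|`, which the span of `v` attains. The chain `span
  -- v ≤ U ≤ ⨆ Ui ≤ span w` therefore collapses, and `w` itself is independent.
  have heq : Submodule.span F (Set.range v) = Submodule.span F (Set.range w) := by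
    refine Submodule.eq_of_le_of_finrank_le hle ?_
    rw [hcard]
    exact finrank_range_le_card w
  have hw : LinearIndependent F w := by
    rw [linearIndependent_iff_card_eq_finrank_span]
    change _ = Module.finrank F (Submodule.span F (Set.range w))
    rw [← heq, hcard]
  have hT := iSupIndep_span_range hw
  have hTU : ⨆ i, T i ≤ U := iSup_le fun i => (hTle i).trans (heq ▸ hspan)
  refine ⟨⟨le_antisymm hU ((iSup_mono hUi).trans hTU), hT.mono hUi⟩, fun i => ?_⟩
  rw [eq_of_le_of_iSup_eq hT hUi (hTU.trans hU) i]
  exact finrank_span_eq_card (hw.comp (fun k => (i, k)) (Prod.mk_right_injective i))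

end Spans

/-! ### Monomials and forms of fixed degree. -/

section Monomials

variable {F : Type*} [Field F] {N r : ℕ}

theorem Mon.degree_eq (M : Mon N r) : M.1.degree = r := by
  have h := (Finset.mem_finsuppAntidiag.1 M.2).1
  rw [Finsupp.degree_eq_sum]
  exact h

theorem mem_mon_iff (α : Fin N →₀ ℕ) :
    α ∈ Finset.finsuppAntidiag (Finset.univ : Finset (Fin N)) r ↔ α.degree = r := by
  rw [Finset.mem_finsuppAntidiag, Finsupp.degree_eq_sum]
  simp

theorem card_mon (N r : ℕ) : Fintype.card (Mon N r) = (N + r - 1).choose r := by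
  rw [Fintype.card_coe, Finset.card_finsuppAntidiag_nat_eq_choose, Finset.card_univ,
    Fintype.card_fin]

/-- Every monomial of degree `r` is the product of some `r`-tuple of variables. -/
theorem card_mon_le (N r : ℕ) : Fintype.card (Mon N r) ≤ N ^ r := by
  let f : (Fin r → Fin N) → Mon N r := fun g =>
    ⟨∑ j, Finsupp.single (g j) 1, by rw [mem_mon_iff]; simp⟩
  have hf : Function.Surjective f := by
    rintro ⟨α, hα⟩
    rw [mem_mon_iff] at hα
    have hc : α.toMultiset.toList.length = r := by
      rw [Multiset.length_toList, Finsupp.card_toMultiset, ← hα]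
      rfl
    subst hc
    refine ⟨fun j => α.toMultiset.toList.get j, ?_⟩
    apply Subtype.ext
    apply Multiset.toFinsupp.symm.injective
    simp only [Multiset.toFinsupp_symm_apply]
    simp only [f, map_sum, Finsupp.toMultiset_single, one_smul]
    conv_rhs => rw [← Multiset.coe_toList α.toMultiset]
    generalize α.toMultiset.toList = l
    rw [← List.sum_ofFn]
    induction l with
    | nil => simp
    | cons a l ih =>
      simp only [List.get_eq_getElem, List.ofFn_getElem_eq_map] at ih ⊢
      rw [List.map_cons, List.sum_cons, ih, Multiset.singleton_add, Multiset.cons_coe]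
  simpa using Fintype.card_le_of_surjective f hf

theorem form_coeff {Q : MvPolynomial (Fin N) F} (hQ : Q.IsHomogeneous r) :
    form (fun α : Mon N r => coeff α.1 Q) = Q := by
  classical
  ext β
  simp only [form, coeff_sum, coeff_monomial]
  by_cases hβ : β.degree = r
  · rw [Finset.sum_eq_single ⟨β, (mem_mon_iff β).2 hβ⟩]
    · simp
    · intro α _ hα
      rw [if_neg fun h => hα (Subtype.ext h)]
    · simp
  · rw [hQ.coeff_eq_zero hβ]
    refine Finset.sum_eq_zero fun α _ => if_neg ?_
    rintro rfl
    exact hβ α.degree_eq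

theorem form_isHomogeneous (a : Mon N r → F) : (form a).IsHomogeneous r :=
  IsHomogeneous.sum _ _ _ fun α _ => isHomogeneous_monomial _ α.degree_eq

theorem form_eq_sum_smul (a : Mon N r → F) : form a = ∑ α, a α • monomial α.1 (1 : F) := by
  simp [form, smul_monomial]

theorem shifts_eq_span (g : MvPolynomial (Fin N) F) :
    shifts r g = Submodule.span F (Set.range fun M : Mon N r => monomial M.1 1 * g) := by
  rw [shifts]
  congr 1
  ext h
  constructor
  · rintro ⟨β, hβ, rfl⟩
    exact ⟨⟨β, (mem_mon_iff β).2 hβ⟩, rfl⟩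
  · rintro ⟨M, rfl⟩
    exact ⟨M.1, M.degree_eq, rfl⟩

theorem mul_mem_shifts {h : MvPolynomial (Fin N) F} (hh : h.IsHomogeneous r)
    (g : MvPolynomial (Fin N) F) : h * g ∈ shifts r g := by
  rw [← form_coeff hh, form_eq_sum_smul, Finset.sum_mul]
  refine Submodule.sum_mem _ fun α _ => ?_
  rw [smul_mul_assoc]
  exact Submodule.smul_mem _ _ (Submodule.subset_span ⟨α.1, α.degree_eq, rfl⟩)

theorem iSupIndep_shifts {ι : Type*} {g : ι → MvPolynomial (Fin N) F}
    (h : LinearIndependent F fun x : ι × Mon N r => monomial x.2.1 1 * g x.1) :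
    iSupIndep fun i => shifts r (g i) := by
  have hs : (fun i => shifts r (g i)) = fun i =>
      Submodule.span F (Set.range fun M : Mon N r => monomial M.1 1 * g i) :=
    funext fun i => shifts_eq_span (g i)
  rw [hs]
  exact iSupIndep_span_range (w := fun x : ι × Mon N r => monomial x.2.1 1 * g x.1) h

end Monomials

/-! ### Projected derivatives of powers. -/

section Partials

variable {σ τ F : Type*} [Field F]

/-- The iterated partial derivative along a list of variables. -/
noncomputable def listDeriv (l : List σ) : MvPolynomial σ F →ₗ[F] MvPolynomial σ F :=
  l.foldr (fun i T => (pderiv i).toLinearMap ∘ₗ T) LinearMap.id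

@[simp] theorem listDeriv_nil (f : MvPolynomial σ F) : listDeriv [] f = f := rfl

@[simp] theorem listDeriv_cons (i : σ) (l : List σ) (f : MvPolynomial σ F) :
    listDeriv (i :: l) f = pderiv i (listDeriv l f) := rfl

theorem foldr_pderiv (l : List σ) (f : MvPolynomial σ F) :
    l.foldr (fun i h => pderiv i h) f = listDeriv l f := by
  induction l with
  | nil => rfl
  | cons i l ih => rw [List.foldr_cons, ih, listDeriv_cons]

theorem listDeriv_mem_app (L : σ → MvPolynomial τ F) (l : List σ) (f : MvPolynomial σ F) :
    proj L (listDeriv l f) ∈ app L l.length f :=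
  Submodule.subset_span ⟨_, ⟨l, rfl, (foldr_pderiv l f).symm⟩, rfl⟩

theorem app_le_iff (L : σ → MvPolynomial τ F) (k : ℕ) (f : MvPolynomial σ F)
    (U : Submodule F (MvPolynomial τ F)) :
    app L k f ≤ U ↔ ∀ l : List σ, l.length = k → proj L (listDeriv l f) ∈ U := by
  rw [app, Submodule.span_le]
  constructor
  · intro h l hl
    exact h ⟨_, ⟨l, hl, (foldr_pderiv l f).symm⟩, rfl⟩
  · rintro h _ ⟨_, ⟨l, hl, rfl⟩, rfl⟩
    rw [foldr_pderiv]
    exact h l hl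

theorem app_sum_le {ι : Type*} [Fintype ι] (L : σ → MvPolynomial τ F) (k : ℕ) (c : ι → F)
    (g : ι → MvPolynomial σ F) : app L k (∑ i, C (c i) * g i) ≤ ⨆ i, app L k (g i) := by
  rw [app_le_iff]
  rintro l rfl
  simp only [← smul_eq_C_mul, map_sum, map_smul]
  exact Submodule.sum_mem _ fun i _ =>
    Submodule.mem_iSup_of_mem i (Submodule.smul_mem _ _ (listDeriv_mem_app L l _))

/-- By the product rule each derivation costs one factor `Q` and raises the degree of the cofactor
by `t - 1`. -/
theorem exists_listDeriv_pow {t m : ℕ} (ht : 1 ≤ t) {Q : MvPolynomial σ F} (hQ : Q.IsHomogeneous t)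
    (l : List σ) (hl : l.length ≤ m) :
    ∃ h : MvPolynomial σ F, h.IsHomogeneous (l.length * (t - 1)) ∧
      listDeriv l (Q ^ m) = h * Q ^ (m - l.length) := by
  induction l with
  | nil => exact ⟨1, by simpa using isHomogeneous_one σ F, by simp⟩
  | cons i l ih =>
    rw [List.length_cons] at hl
    obtain ⟨h, hh, he⟩ := ih (by omega)
    obtain ⟨j, hj⟩ : ∃ j, m - l.length = j + 1 := ⟨m - l.length - 1, by omega⟩
    refine ⟨C ((j + 1 : ℕ) : F) * (h * pderiv i Q) + pderiv i h * Q, ?_, ?_⟩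
    · rw [List.length_cons, Nat.succ_mul]
      refine ((hh.mul hQ.pderiv).C_mul _).add ?_
      -- In degree zero the truncated subtraction gives the wrong degree for `pderiv i h`, but then
      -- `h` is constant and this term vanishes.
      rcases Nat.eq_zero_or_pos (l.length * (t - 1)) with h0 | h0
      · rw [h0, ← totalDegree_zero_iff_isHomogeneous, totalDegree_eq_zero_iff_eq_C] at hh
        rw [hh, pderiv_C, zero_mul]
        exact isHomogeneous_zero _ _ _
      · convert hh.pderiv.mul hQ using 1
        omega
    · rw [listDeriv_cons, he, hj, List.length_cons, show m - (l.length + 1) = j by omega,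
        pderiv_mul, pderiv_pow]
      simp
      ring

/-- The upper bound on the dimension of each summand: the spanning set on the right is indexed by
monomials. -/
theorem app_pow_le {N t k m : ℕ} (ht : 1 ≤ t) (hk : k ≤ m) {Q : MvPolynomial σ F}
    (hQ : Q.IsHomogeneous t) {L : σ → MvPolynomial (Fin N) F} (hL : IsLinearTuple L) :
    app L k (Q ^ m) ≤ shifts (k * (t - 1)) (proj L Q ^ (m - k)) := by
  rw [app_le_iff]
  rintro l rfl
  obtain ⟨h, hh, he⟩ := exists_listDeriv_pow ht hQ l hk
  rw [he, map_mul, map_pow]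
  refine mul_mem_shifts ?_ _
  have := hh.aeval L hL
  rwa [one_mul] at this

/-- The criterion for the spaces of projected derivatives of a sum of powers to form a direct sum
of maximal dimension. -/
theorem isDirectSum_app {ι : Type*} [Fintype ι] {N t k m : ℕ} (ht : 1 ≤ t) (hk : k ≤ m)
    {Q : ι → MvPolynomial σ F} (hQ : ∀ i, (Q i).IsHomogeneous t) {L : σ → MvPolynomial (Fin N) F}
    (hL : IsLinearTuple L) (c : ι → F) (l : ι × Mon N (k * (t - 1)) → List σ)
    (hl : ∀ x, (l x).length = k)
    (h : LinearIndependent F fun x => proj L (listDeriv (l x) (∑ i, C (c i) * Q i ^ m))) :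
    IsDirectSum (app L k (∑ i, C (c i) * Q i ^ m)) (fun i => app L k (Q i ^ m)) ∧
      ∀ i, Module.finrank F (app L k (Q i ^ m)) = (N + k * (t - 1) - 1).choose (k * (t - 1)) := by
  rw [← card_mon]
  refine isDirectSum_of_linearIndependent
    (w := fun x : ι × Mon N (k * (t - 1)) => monomial x.2.1 1 * proj L (Q x.1) ^ (m - k)) h
    (fun x => ?_) (app_sum_le L k c _) fun i => ?_
  · have := listDeriv_mem_app L (l x) (∑ i, C (c i) * Q i ^ m)
    rwa [hl x] at this
  · refine (app_pow_le ht hk (hQ i) hL).trans (le_of_eq ?_)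
    exact shifts_eq_span _

end Partials


/-! ### Independence of shifted powers of linear forms. -/

section ShiftedPowers

variable {σ F : Type*} [Field F]

theorem pderiv_eq_zero_of_isHomogeneous_zero {p : MvPolynomial σ F} (hp : p.IsHomogeneous 0)
    (u : σ) : pderiv u p = 0 := by
  rw [← totalDegree_zero_iff_isHomogeneous, totalDegree_eq_zero_iff_eq_C] at hp
  rw [hp, pderiv_C]

/-- The last entry of a list acts first; hence the reverse inductions below, in which `p` and `D`
vary. -/
theorem listDeriv_concat (l : List σ) (i : σ) (f : MvPolynomial σ F) :
    listDeriv (l ++ [i]) f = listDeriv l (pderiv i f) := by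
  induction l with
  | nil => rfl
  | cons j l ih => rw [List.cons_append, listDeriv_cons, ih, listDeriv_cons]

/-- The operator `p ↦ D p + ℓ ∂p`, where `∂ℓ = 1`, is injective on forms. -/
theorem eq_zero_of_natCast_mul_add_mul_pderiv {ℓ : MvPolynomial σ F} {u : σ}
    (hu : pderiv u ℓ = 1) (r : ℕ) : ∀ (D : ℕ) (p : MvPolynomial σ F), p.IsHomogeneous r →
      (∀ j, D ≤ j → j ≤ D + r → (j : F) ≠ 0) → C (D : F) * p + ℓ * pderiv u p = 0 → p = 0 := by
  have hℓ : ℓ ≠ 0 := by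
    rintro rfl
    simp at hu
  induction r with
  | zero =>
    intro D p hp hD h
    rw [pderiv_eq_zero_of_isHomogeneous_zero hp, mul_zero, add_zero] at h
    exact (mul_eq_zero.1 h).resolve_left
      (fun hC => hD D le_rfl (by omega) (C_eq_zero.1 hC))
  | succ r ih =>
    intro D p hp hD h
    have hD0 : (D : F) ≠ 0 := hD D le_rfl (by omega)
    -- The relation says `p = ℓ * p₁`. Substituting this and cancelling `ℓ` gives the same relation
    -- for `p₁`, with `D + 1` for `D` and in one degree less.
    set p₁ := -(C ((D : F)⁻¹) * pderiv u p) with hp₁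
    have hC : C (D : F) * C ((D : F)⁻¹) = (1 : MvPolynomial σ F) := by
      rw [← C_mul, mul_inv_cancel₀ hD0, C_1]
    have hp₁p : p = ℓ * p₁ := by
      have : C ((D : F)⁻¹) * (C (D : F) * p + ℓ * pderiv u p) = 0 := by rw [h, mul_zero]
      rw [mul_add, ← mul_assoc, mul_comm (C _) (C _), hC, one_mul] at this
      rw [hp₁]
      linear_combination this
    have hhom : p₁.IsHomogeneous r := (hp.pderiv.C_mul _).neg
    have h₁ : p₁ = 0 := by
      refine ih (D + 1) p₁ hhom (fun j hj hj' => hD j (by omega) (by omega)) ?_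
      refine (mul_eq_zero.1 (?_ : ℓ * _ = 0)).resolve_left hℓ
      rw [hp₁p, pderiv_mul, hu] at h
      push_cast
      rw [C_add, C_1]
      linear_combination h
    rw [hp₁p, h₁, mul_zero]

variable {ℓ : MvPolynomial σ F}

theorem pderiv_mul_pow_of_pderiv_eq_one {u : σ} (hu : pderiv u ℓ = 1) (p : MvPolynomial σ F)
    (D : ℕ) : pderiv u (p * ℓ ^ (D + 1)) =
      (C ((D + 1 : ℕ) : F) * p + ℓ * pderiv u p) * ℓ ^ D := by
  rw [pderiv_mul, pderiv_pow, hu]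
  simp
  ring

theorem pderiv_mul_pow_of_pderiv_eq_zero {u : σ} (hu : pderiv u ℓ = 0) (p : MvPolynomial σ F)
    (D : ℕ) : pderiv u (p * ℓ ^ D) = pderiv u p * ℓ ^ D := by
  rw [pderiv_mul, pderiv_pow, hu]
  simp

theorem isHomogeneous_natCast_mul_add (hℓ : ℓ.IsHomogeneous 1) (u : σ) {p : MvPolynomial σ F}
    {r : ℕ} (hp : p.IsHomogeneous r) (a : F) : (C a * p + ℓ * pderiv u p).IsHomogeneous r := by
  refine (hp.C_mul _).add ?_
  rcases r with _ | r
  · rw [pderiv_eq_zero_of_isHomogeneous_zero hp, mul_zero]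
    exact isHomogeneous_zero _ _ _
  · convert hℓ.mul hp.pderiv using 1
    omega

/-- A derivation with `∂ℓ = 0` lowers the degree of the cofactor `p`; one with `∂ℓ = 1` preserves it
and lowers `D`. More than `r` of the first kind exhaust a cofactor of degree `r`. -/
theorem listDeriv_mul_pow_eq_zero [DecidableEq (MvPolynomial σ F)] (hℓ : ℓ.IsHomogeneous 1)
    (l : List σ) :
    ∀ (D r : ℕ) (p : MvPolynomial σ F), p.IsHomogeneous r → l.length ≤ D →
      (∀ u ∈ l, pderiv u ℓ = 0 ∨ pderiv u ℓ = 1) → r < l.countP (fun u => pderiv u ℓ = 0) →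
      listDeriv l (p * ℓ ^ D) = 0 := by
  induction l using List.reverseRecOn with
  | nil => simp
  | append_singleton l u ih =>
    intro D r p hp hD hl hr
    rw [listDeriv_concat]
    rw [List.length_append, List.length_singleton] at hD
    rw [List.countP_append, List.countP_singleton] at hr
    rcases hl u (by simp) with hu | hu
    · rw [pderiv_mul_pow_of_pderiv_eq_zero hu]
      rcases r with _ | r
      · rw [pderiv_eq_zero_of_isHomogeneous_zero hp, zero_mul, map_zero]
      · refine ih D r _ hp.pderiv (by omega) (fun v hv => hl v (by simp [hv])) ?_
        simp only [hu, decide_true, if_true] at hr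
        omega
    · obtain ⟨D, rfl⟩ : ∃ D', D = D' + 1 := ⟨D - 1, by omega⟩
      rw [pderiv_mul_pow_of_pderiv_eq_one hu]
      refine ih D r _ (isHomogeneous_natCast_mul_add hℓ u hp _) (by omega)
        (fun v hv => hl v (by simp [hv])) ?_
      simpa [hu] using hr

/-- Each derivation replaces the cofactor `p` by `D p + ℓ ∂p`, an injective operation as long as the
integers involved are nonzero in `F`. -/
theorem eq_zero_of_listDeriv_mul_pow_eq_zero (hℓ : ℓ.IsHomogeneous 1) (hℓ0 : ℓ ≠ 0) {r : ℕ}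
    (l : List σ) :
    ∀ (D : ℕ) (p : MvPolynomial σ F), p.IsHomogeneous r → l.length ≤ D →
      (∀ j, 1 ≤ j → j ≤ D + r → (j : F) ≠ 0) → (∀ u ∈ l, pderiv u ℓ = 1) →
      listDeriv l (p * ℓ ^ D) = 0 → p = 0 := by
  induction l using List.reverseRecOn with
  | nil =>
    intro D p _ _ _ _ h
    exact (mul_eq_zero.1 h).resolve_right (pow_ne_zero _ hℓ0)
  | append_singleton l u ih =>
    intro D p hp hD hF hl h
    have hu := hl u (by simp)
    rw [List.length_append, List.length_singleton] at hD
    obtain ⟨D, rfl⟩ : ∃ D', D = D' + 1 := ⟨D - 1, by omega⟩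
    rw [listDeriv_concat, pderiv_mul_pow_of_pderiv_eq_one hu] at h
    refine eq_zero_of_natCast_mul_add_mul_pderiv hu r (D + 1) p hp
      (fun j hj hj' => hF j (by omega) hj') ?_
    exact ih D _ (isHomogeneous_natCast_mul_add hℓ u hp _) (by omega)
      (fun j hj hj' => hF j hj (by omega)) (fun v hv => hl v (by simp [hv])) h

theorem coeff_form {N r : ℕ} (a : Mon N r → F) (M : Mon N r) : coeff M.1 (form a) = a M := by
  classical
  simp only [form, coeff_sum, coeff_monomial]
  rw [Finset.sum_eq_single M]
  · simp
  · intro α _ hα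
    rw [if_neg fun h => hα (Subtype.ext h)]
  · simp

/-- Applied to a relation `∑ p_j ℓ_j ^ D = 0`, the operator of `l i` kills every term but the `i`-th
and is injective on that one, so `p_i = 0`. -/
theorem linearIndependent_shifted_powers {ι : Type*} [Fintype ι]
    {N r D : ℕ} [DecidableEq (MvPolynomial (Fin N) F)]
    {ℓ : ι → MvPolynomial (Fin N) F} (hℓ : ∀ i, (ℓ i).IsHomogeneous 1) (hℓ0 : ∀ i, ℓ i ≠ 0)
    (l : ι → List (Fin N)) (hlD : ∀ i, (l i).length ≤ D)
    (hF : ∀ j, 1 ≤ j → j ≤ D + r → (j : F) ≠ 0) (hl1 : ∀ i, ∀ u ∈ l i, pderiv u (ℓ i) = 1)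
    (hl : ∀ i j, ∀ u ∈ l i, pderiv u (ℓ j) = 0 ∨ pderiv u (ℓ j) = 1)
    (hr : ∀ i j, j ≠ i → r < (l i).countP (fun u => pderiv u (ℓ j) = 0)) :
    LinearIndependent F fun x : ι × Mon N r => monomial x.2.1 1 * ℓ x.1 ^ D := by
  rw [Fintype.linearIndependent_iff]
  rintro g hg ⟨i, M⟩
  have hsum : ∑ j, form (fun M => g (j, M)) * ℓ j ^ D = 0 := by
    rw [← hg, Fintype.sum_prod_type]
    refine Finset.sum_congr rfl fun j _ => ?_
    rw [form_eq_sum_smul, Finset.sum_mul]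
    simp only [smul_mul_assoc]
  have h := congrArg (listDeriv (l i)) hsum
  rw [map_sum, map_zero, Finset.sum_eq_single i] at h
  · have h0 := eq_zero_of_listDeriv_mul_pow_eq_zero (hℓ i) (hℓ0 i) (l i) D _
      (form_isHomogeneous _) (hlD i) hF (hl1 i) h
    rw [← coeff_form (fun M => g (i, M)) M, h0, coeff_zero]
  · intro j _ hj
    exact listDeriv_mul_pow_eq_zero (hℓ j) (l i) D r _ (form_isHomogeneous _) (hlD i)
      (hl i j) (hr i j hj)
  · simp

end ShiftedPowers

/-! ### Linear forms from Reed–Solomon codes. -/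

section Codes

/-- Reed–Solomon codes. -/
theorem exists_code {s q κ A : ℕ} (hq : q.Prime) (hA : A ≤ q) (hs : s ≤ q ^ κ) :
    ∃ w : Fin s → Fin A → Fin q, ∀ i j, i ≠ j →
      (Finset.univ.filter fun a => w i a = w j a).card ≤ κ := by
  classical
  have := Fact.mk hq
  let e : ZMod q ≃ Fin q := Fintype.equivFinOfCardEq (ZMod.card q)
  have hcard : Fintype.card (Fin s) ≤ Fintype.card (Fin κ → ZMod q) := by simpa using hs
  obtain ⟨f⟩ := Function.Embedding.nonempty_of_card_le hcard
  let P : (Fin κ → ZMod q) → Polynomial (ZMod q) := fun u => ∑ j : Fin κ, Polynomial.monomial j (u j)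
  have hPc : ∀ u (j : Fin κ), (P u).coeff j = u j := fun u j => by
    simp [P, Polynomial.coeff_monomial, Fin.val_inj]
  have hPd : ∀ u, (P u).natDegree ≤ κ := fun u =>
    Polynomial.natDegree_sum_le_of_forall_le _ _ fun j _ =>
      (Polynomial.natDegree_monomial_le _).trans j.2.le
  refine ⟨fun i a => e ((P (f i)).eval ((a : ℕ) : ZMod q)), fun i j hij => ?_⟩
  have hne : P (f i) - P (f j) ≠ 0 := fun h => hij (f.injective (funext fun x => by
    rw [← hPc (f i) x, sub_eq_zero.1 h, hPc]))
  calc _ = (Finset.image (fun a : Fin A => ((a : ℕ) : ZMod q))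
        (Finset.univ.filter fun a : Fin A => e ((P (f i)).eval ((a : ℕ) : ZMod q)) =
          e ((P (f j)).eval ((a : ℕ) : ZMod q)))).card := by
        refine (Finset.card_image_of_injective _ fun (a b : Fin A) hab => ?_).symm
        have := (ZMod.natCast_eq_natCast_iff' _ _ _).1 hab
        rw [Nat.mod_eq_of_lt (a.2.trans_le hA), Nat.mod_eq_of_lt (b.2.trans_le hA)] at this
        exact Fin.ext this
    _ ≤ (P (f i) - P (f j)).roots.toFinset.card := by
        refine Finset.card_le_card fun x hx => ?_
        obtain ⟨a, ha, rfl⟩ := Finset.mem_image.1 hx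
        have ha' := e.injective (Finset.mem_filter.1 ha).2
        rw [Multiset.mem_toFinset, Polynomial.mem_roots hne, Polynomial.IsRoot, Polynomial.eval_sub,
          ha', sub_self]
    _ ≤ _ := (Multiset.toFinset_card_le _).trans (Polynomial.card_roots' _)
    _ ≤ κ := (Polynomial.natDegree_sub_le _ _).trans (max_le (hPd _) (hPd _))

variable {F : Type*} [Field F] {A q N : ℕ}

/-- The linear form attached to a word `w` over the alphabet `Fin q`. -/
noncomputable def wordForm (F : Type*) [Field F] (φ : Fin A × Fin q ↪ Fin N) (w : Fin A → Fin q) :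
    MvPolynomial (Fin N) F :=
  ∑ a, X (φ (a, w a))

theorem wordForm_isHomogeneous (φ : Fin A × Fin q ↪ Fin N) (w : Fin A → Fin q) :
    (wordForm F φ w).IsHomogeneous 1 :=
  IsHomogeneous.sum _ _ _ fun _ _ => isHomogeneous_X _ _

theorem pderiv_wordForm (φ : Fin A × Fin q ↪ Fin N) (w : Fin A → Fin q) (a : Fin A) (b : Fin q) :
    pderiv (φ (a, b)) (wordForm F φ w) = if w a = b then 1 else 0 := by
  classical
  rw [wordForm, map_sum, Finset.sum_eq_single a]
  · simp [pderiv_X, Pi.single_apply, eq_comm]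
  · intro a' _ ha'
    rw [pderiv_X_of_ne]
    simp [ha']
  · simp

theorem wordForm_ne_zero (hA : 0 < A) (φ : Fin A × Fin q ↪ Fin N) (w : Fin A → Fin q) :
    wordForm F φ w ≠ 0 := by
  intro h
  have := pderiv_wordForm (F := F) φ w ⟨0, hA⟩ (w ⟨0, hA⟩)
  simp [h] at this

/-- Shifted powers of linear forms attached to the words of a code of large minimum distance are
linearly independent. -/
theorem linearIndependent_wordForm {s κ c r D : ℕ} (hA : 0 < A) (φ : Fin A × Fin q ↪ Fin N)
    (w : Fin s → Fin A → Fin q)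
    (hw : ∀ i j, i ≠ j → (Finset.univ.filter fun a => w i a = w j a).card ≤ κ)
    (hcA : c * A ≤ D) (hr : r < c * (A - κ)) (hF : ∀ j, 1 ≤ j → j ≤ D + r → (j : F) ≠ 0) :
    LinearIndependent F fun x : Fin s × Mon N r => monomial x.2.1 1 * wordForm F φ (w x.1) ^ D := by
  classical
  refine linearIndependent_shifted_powers (ℓ := fun i => wordForm F φ (w i)) (fun i => wordForm_isHomogeneous φ _)
    (fun i => wordForm_ne_zero hA φ _)
    -- Differentiate `c` times in each variable of the `i`-th form. Another word differs from `w i`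
    -- in at least `A - κ` positions, each giving `c` derivations that annihilate its form.
    (fun i => (List.finRange A).flatMap fun a => List.replicate c (φ (a, w i a))) (fun i => ?_) hF
    (fun i u hu => ?_) (fun i j u hu => ?_) (fun i j hij => ?_)
  · simpa [List.length_flatMap, mul_comm] using hcA
  · simp only [List.mem_flatMap, List.mem_replicate] at hu
    obtain ⟨a, -, -, rfl⟩ := hu
    simp [pderiv_wordForm]
  · simp only [List.mem_flatMap, List.mem_replicate] at hu
    obtain ⟨a, -, -, rfl⟩ := hu
    rw [pderiv_wordForm]
    split_ifs <;> simp
  · refine hr.trans_le ?_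
    rw [List.countP_flatMap]
    have h1 : ((List.countP fun u => decide (pderiv u (wordForm F φ (w j)) = 0)) ∘
        fun a => List.replicate c (φ (a, w i a))) = fun a => if w j a = w i a then 0 else c := by
      ext a
      simp only [Function.comp_apply, List.countP_replicate, pderiv_wordForm]
      split_ifs <;> simp_all
    rw [h1, ← List.ofFn_eq_map, List.sum_ofFn, Finset.sum_ite, Finset.sum_const_zero, zero_add,
      Finset.sum_const, smul_eq_mul, mul_comm]
    refine Nat.mul_le_mul_right _ ?_
    have h2 := Finset.card_filter_add_card_filter_not (s := (Finset.univ : Finset (Fin A)))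
      (fun a => w j a = w i a)
    have h3 := hw j i hij
    rw [Finset.card_univ, Fintype.card_fin] at h2
    omega

end Codes


/-! ### Restriction to the first variables. -/

section Restriction

variable (F : Type*) [Field F] (N N₀ : ℕ)

/-- The tuple of linear forms which keeps the first `N₀` variables and kills the others. -/
noncomputable def restr : Fin N → MvPolynomial (Fin N₀) F :=
  fun j => if h : (j : ℕ) < N₀ then X ⟨j, h⟩ else 0

variable {F N N₀}

theorem restr_isLinearTuple : IsLinearTuple (restr F N N₀) := by
  intro j
  rw [restr]
  split_ifs
  · exact isHomogeneous_X _ _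
  · exact isHomogeneous_zero _ _ _

theorem proj_restr_rename (h : N₀ ≤ N) (p : MvPolynomial (Fin N₀) F) :
    proj (restr F N N₀) (rename (Fin.castLE h) p) = p := by
  rw [proj, aeval_rename]
  have : restr F N N₀ ∘ Fin.castLE h = X := by
    ext1 j
    simp [restr]
  rw [this, aeval_X_left_apply]

theorem proj_restr_X {j : Fin N} (h : N₀ ≤ j) : proj (restr F N N₀) (X j) = 0 := by
  rw [proj, aeval_X, restr, dif_neg (by omega)]

theorem pderiv_rename_castLE (h : N₀ ≤ N) (p : MvPolynomial (Fin N₀) F) {j : Fin N}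
    (hj : N₀ ≤ j) : pderiv j (rename (Fin.castLE h) p) = 0 := by
  classical
  refine pderiv_eq_zero_of_notMem_vars fun hmem => ?_
  obtain ⟨i, -, hi⟩ := Finset.mem_image.1 (vars_rename _ _ hmem)
  rw [← hi, Fin.val_castLE] at hj
  exact absurd i.2 (by omega)

end Restriction

/-! ### Forms whose powers are separated by derivatives. -/

section Witness

variable {σ F : Type*} [Field F]

theorem exists_le_degree_eq (α : σ →₀ ℕ) (r : ℕ) (hr : r ≤ α.degree) :
    ∃ β ≤ α, β.degree = r := by
  classical
  induction r with
  | zero => exact ⟨0, by simp, by simp⟩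
  | succ r ih =>
    obtain ⟨β, hβ, hd⟩ := ih (by omega)
    obtain ⟨j, hj⟩ : ∃ j, β j < α j := by
      by_contra! h
      have : α ≤ β := h
      rw [le_antisymm this hβ] at hr
      omega
    refine ⟨β + Finsupp.single j 1, fun i => ?_, by simp [hd]⟩
    rw [Finsupp.add_apply, Finsupp.single_apply]
    split_ifs with h
    · subst h; omega
    · simpa using hβ i

theorem exists_sum_eq_mon {N r k : ℕ} (M : Mon N (k * r)) :
    ∃ μ : Fin k → Mon N r, ∑ a, (μ a).1 = M.1 := by
  suffices h : ∀ α : Fin N →₀ ℕ, α.degree = k * r → ∃ μ : Fin k → Mon N r, ∑ a, (μ a).1 = α from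
    h M.1 M.degree_eq
  clear M
  intro α hα
  induction k generalizing α with
  | zero =>
    refine ⟨Fin.elim0, ?_⟩
    rw [Nat.zero_mul, Finsupp.degree_eq_zero_iff] at hα
    simp [hα]
  | succ k ih =>
    rw [Nat.succ_mul] at hα
    obtain ⟨β, hβ, hd⟩ := exists_le_degree_eq α r (by omega)
    have hsub : α - β + β = α := tsub_add_cancel_of_le hβ
    have hdeg : (α - β).degree = k * r := by
      have := congrArg Finsupp.degree hsub
      rw [map_add] at this
      omega
    obtain ⟨μ, hμ⟩ := ih (α - β) hdeg
    refine ⟨Fin.cons ⟨β, (mem_mon_iff β).2 hd⟩ μ, ?_⟩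
    rw [Fin.sum_univ_succ]
    simp only [Fin.cons_zero, Fin.cons_succ]
    rw [hμ, add_comm, hsub]

theorem pderiv_prod_map_eq_zero {Q : MvPolynomial σ F} {u : σ} (l : List σ)
    (h : ∀ v ∈ l, pderiv u (pderiv v Q) = 0) :
    pderiv u (l.map fun v => pderiv v Q).prod = 0 := by
  induction l with
  | nil => simp
  | cons v l ih =>
    rw [List.map_cons, List.prod_cons, pderiv_mul, h v (by simp),
      ih fun w hw => h w (by simp [hw])]
    simp

/-- As the second derivatives vanish, the factors `∂Q` already produced behave as constants for the
later derivations. -/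
theorem listDeriv_pow {Q : MvPolynomial σ F} {m : ℕ} (l : List σ) (hl : l.length ≤ m)
    (h : ∀ u ∈ l, ∀ v ∈ l, pderiv u (pderiv v Q) = 0) :
    listDeriv l (Q ^ m) =
      C (m.descFactorial l.length : F) * Q ^ (m - l.length) * (l.map fun v => pderiv v Q).prod := by
  induction l with
  | nil => simp
  | cons u l ih =>
    rw [List.length_cons] at hl
    obtain ⟨j, hj⟩ : ∃ j, m - l.length = j + 1 := ⟨m - l.length - 1, by omega⟩
    rw [listDeriv_cons, ih (by omega) fun v hv w hw => h v (by simp [hv]) w (by simp [hw]),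
      pderiv_mul, pderiv_prod_map_eq_zero l fun v hv => h u (by simp) v (by simp [hv]),
      pderiv_C_mul, pderiv_pow, hj, List.length_cons, Nat.descFactorial_succ,
      show m - (l.length + 1) = j by omega, hj, List.map_cons, List.prod_cons]
    simp
    ring

/-- Forms of degree `t` with prescribed restrictions `G i`, for which the projected derivatives of
order `k` of a linear combination of the `m`-th powers separate the summands. -/
theorem exists_linearIndependent_listDeriv {N N₀ s t k m B : ℕ} (ht : 1 ≤ t) (hk : k ≤ m)
    (hN : N₀ + k * B * Fintype.card (Mon N₀ (t - 1)) ≤ N) (hs : s ≤ B ^ k) (c : Fin s → F)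
    (hc : ∀ i, c i ≠ 0) (hF : (m.descFactorial k : F) ≠ 0) (G : Fin s → MvPolynomial (Fin N₀) F)
    (hG : ∀ i, (G i).IsHomogeneous t)
    (hLI : LinearIndependent F fun x : Fin s × Mon N₀ (k * (t - 1)) =>
      monomial x.2.1 1 * G x.1 ^ (m - k)) :
    ∃ (l : Fin s × Mon N₀ (k * (t - 1)) → List (Fin N)) (Q : Fin s → MvPolynomial (Fin N) F),
      (∀ x, (l x).length = k) ∧ (∀ i, (Q i).IsHomogeneous t) ∧
      LinearIndependent F fun x =>
        proj (restr F N N₀) (listDeriv (l x) (∑ i, C (c i) * Q i ^ m)) := by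
  classical
  have hNN : N₀ ≤ N := by omega
  -- Fresh variables, indexed by a slot, a letter and a monomial. `Q i` contains those whose letter
  -- is the one that the label `δ i` has in that slot, each times its monomial.
  let K := Fin k × Fin B × Mon N₀ (t - 1)
  have hcard : Fintype.card K ≤ Fintype.card (Fin (N - N₀)) := by
    simp only [K, Fintype.card_prod, Fintype.card_fin, ← mul_assoc]
    omega
  obtain ⟨ψ₀⟩ := Function.Embedding.nonempty_of_card_le hcard
  let ψ : K → Fin N := fun x => ⟨N₀ + ψ₀ x, by have := (ψ₀ x).2; omega⟩
  have hψ : Function.Injective ψ := fun x y h => ψ₀.injective (Fin.ext (by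
    simpa [ψ] using h))
  have hψN : ∀ x, N₀ ≤ ψ x := fun x => by simp [ψ]
  have hcard' : Fintype.card (Fin s) ≤ Fintype.card (Fin k → Fin B) := by simpa using hs
  obtain ⟨δ⟩ := Function.Embedding.nonempty_of_card_le hcard'
  choose μ hμ using fun M : Mon N₀ (k * (t - 1)) => exists_sum_eq_mon M
  let Q : Fin s → MvPolynomial (Fin N) F := fun i => rename (Fin.castLE hNN) (G i) +
    ∑ x : K, if δ i x.1 = x.2.1 then
      X (ψ x) * rename (Fin.castLE hNN) (monomial x.2.2.1 (1 : F)) else 0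
  have hpd : ∀ i (y : K), pderiv (ψ y) (Q i) = if δ i y.1 = y.2.1 then
      rename (Fin.castLE hNN) (monomial y.2.2.1 (1 : F)) else 0 := by
    intro i y
    simp only [Q]
    rw [map_add, pderiv_rename_castLE hNN _ (hψN y), zero_add, map_sum, Finset.sum_eq_single y]
    · split_ifs
      · rw [pderiv_mul, pderiv_rename_castLE hNN _ (hψN y), pderiv_X_self, one_mul, mul_zero,
          add_zero]
      · rw [map_zero]
    · intro x _ hx
      split_ifs
      · rw [pderiv_mul, pderiv_rename_castLE hNN _ (hψN y), pderiv_X_of_ne (hψ.ne hx), zero_mul,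
          mul_zero, add_zero]
      · rw [map_zero]
    · simp
  have hpd2 : ∀ i (x y : K), pderiv (ψ x) (pderiv (ψ y) (Q i)) = 0 := by
    intro i x y
    rw [hpd]
    split_ifs
    · exact pderiv_rename_castLE hNN _ (hψN x)
    · rw [map_zero]
  have hQG : ∀ i, proj (restr F N N₀) (Q i) = G i := by
    intro i
    simp only [Q]
    rw [map_add, proj_restr_rename, map_sum, Finset.sum_eq_zero, add_zero]
    intro x _
    split_ifs
    · rw [map_mul, proj_restr_X (hψN x), zero_mul]
    · rw [map_zero]
  -- One derivation per slot: on `Q i` they produce the `k` factors of the monomial, while a `Q j`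
  -- with another label has zero derivative in some slot.
  let l : Fin s × Mon N₀ (k * (t - 1)) → List (Fin N) := fun x =>
    List.ofFn fun a => ψ (a, δ x.1 a, μ x.2 a)
  have hl : ∀ x, (l x).length = k := fun x => List.length_ofFn
  have hval : ∀ x, proj (restr F N N₀) (listDeriv (l x) (∑ i, C (c i) * Q i ^ m)) =
      (c x.1 * (m.descFactorial k : F)) • (monomial x.2.1 1 * G x.1 ^ (m - k)) := by
    rintro ⟨i, M⟩
    have hpow : ∀ j, proj (restr F N N₀) (listDeriv (l (i, M)) (Q j ^ m)) =
        if j = i then C (m.descFactorial k : F) * (monomial M.1 1 * G i ^ (m - k)) else 0 := by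
      intro j
      rw [listDeriv_pow _ (by rw [hl]; exact hk), hl, map_mul, map_mul, map_pow, hQG]
      · have hprod : proj (restr F N N₀) ((l (i, M)).map fun v => pderiv v (Q j)).prod =
            if j = i then monomial M.1 1 else 0 := by
          rw [List.map_ofFn, List.prod_ofFn, map_prod]
          split_ifs with hji
          · subst hji
            simp only [Function.comp_apply, hpd, if_true, proj_restr_rename]
            rw [← hμ M, monomial_sum_one]
          · obtain ⟨a, ha⟩ : ∃ a, δ j a ≠ δ i a := by
              by_contra! h
              exact hji (δ.injective (funext h))
            refine Finset.prod_eq_zero (Finset.mem_univ a) ?_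
            simp [hpd, ha]
        rw [hprod]
        split_ifs with hji
        · subst hji
          rw [show proj (restr F N N₀) (C (m.descFactorial k : F)) = C (m.descFactorial k : F) from
            algHom_C _ _]
          ring
        · rw [mul_zero]
      · intro u hu v hv
        obtain ⟨a, rfl⟩ := (List.mem_ofFn' _ _).1 hu
        obtain ⟨b, rfl⟩ := (List.mem_ofFn' _ _).1 hv
        exact hpd2 j _ _
    simp only [map_sum, ← smul_eq_C_mul, map_smul, hpow]
    rw [Finset.sum_eq_single i]
    · rw [if_pos rfl, smul_smul]
    · intro j _ hj
      rw [if_neg hj, smul_zero]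
    · simp
  refine ⟨l, Q, hl, fun i => ?_, ?_⟩
  · refine (hG i).rename_isHomogeneous.add (IsHomogeneous.sum _ _ _ fun x _ => ?_)
    split_ifs
    · convert (isHomogeneous_X F (ψ x)).mul
        (isHomogeneous_monomial (1 : F) x.2.2.degree_eq).rename_isHomogeneous using 1
      omega
    · exact isHomogeneous_zero _ _ _
  · simp only [hval]
    exact hLI.units_smul fun x => Units.mk0 (c x.1 * (m.descFactorial k : F))
      (mul_ne_zero (hc _) hF)

end Witness


/-! ### Probability of non-degeneracy. -/

theorem one_sub_le_uniformProb {ι κ F : Type*} [Field F] [Fintype ι] [Fintype κ]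
    (p : MvPolynomial (ι × κ) F) (hp : p ≠ 0) (S : Finset F) (hS : S.Nonempty)
    (E : (ι → κ → S) → Prop) (hE : ∀ a, eval (fun x => (a x.1 x.2 : F)) p ≠ 0 → E a) :
    1 - (p.totalDegree : ℝ) / S.card ≤ uniformProb E := by
  classical
  have : Nonempty S := hS.to_subtype
  have hS' : (0 : ℝ) < S.card := by exact_mod_cast hS.card_pos
  have hΩ : (0 : ℝ) < Nat.card (ι → κ → S) := by exact_mod_cast Nat.card_pos
  have h1 := card_eval_eq_zero_mul_card_le p hp S hS
  have h2 : Nat.card (ι → κ → S) ≤ Nat.card {a // E a} +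
      Nat.card {a : ι → κ → S // eval (fun x => (a x.1 x.2 : F)) p = 0} := by
    have h3 : Nat.card (ι → κ → S) = Nat.card {a // E a} + Nat.card {a // ¬ E a} := by
      rw [← Nat.card_sum]
      exact (Nat.card_congr (Equiv.sumCompl E)).symm
    rw [h3]
    refine Nat.add_le_add_left (Nat.card_le_card_of_injective
      (fun a => ⟨a.1, not_not.1 fun h => a.2 (hE a.1 h)⟩) ?_) _
    rintro ⟨a, ha⟩ ⟨b, hb⟩ hab
    simpa using hab
  have h4 : (Nat.card (ι → κ → S) : ℝ) ≤ Nat.card {a // E a} +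
      Nat.card {a : ι → κ → S // eval (fun x => (a x.1 x.2 : F)) p = 0} := by exact_mod_cast h2
  rw [uniformProb, le_div_iff₀ hΩ, sub_mul, one_mul, div_mul_eq_mul_div, sub_le_iff_le_add]
  refine h4.trans ?_
  gcongr
  rwa [le_div_iff₀ hS']

/-- Index `0` is left free so that setting `z₁ = 0` does not alter the word forms. -/
theorem exists_embedding_ne_zero {A q N : ℕ} (h : A * q + 1 ≤ N) :
    ∃ φ : Fin A × Fin q ↪ Fin N, ∀ x, (φ x).val ≠ 0 := by
  refine ⟨⟨fun x => ⟨finProdFinEquiv x + 1, ?_⟩, fun x y hxy => ?_⟩, fun x => by simp⟩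
  · have := (finProdFinEquiv x).2
    omega
  · have := Fin.mk.inj_iff.1 hxy
    exact finProdFinEquiv.injective (Fin.ext (by omega))

theorem killFirst_wordForm {F : Type*} [Field F] {A q N : ℕ} (φ : Fin A × Fin q ↪ Fin N)
    (hφ : ∀ x, (φ x).val ≠ 0) (w : Fin A → Fin q) :
    killFirst (wordForm F φ w) = wordForm F φ w := by
  simp [killFirst, wordForm, hφ]

/-- Forms whose coefficients are coordinates depend linearly on them. -/
theorem form_mem_polyFun {F : Type*} [Field F] {s n t : ℕ} (i : Fin s) :
    (fun a : Fin s × Mon n t → F => form fun α => a (i, α)) ∈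
      polyFun (Fin s × Mon n t) F (MvPolynomial (Fin n) F) 1 := by
  simp only [form_eq_sum_smul]
  refine sum_mem_polyFun _ fun α _ => ?_
  simpa using smul_mem_polyFun (X (i, α) : MvPolynomial (Fin s × Mon n t) F)
    (totalDegree_X _).le (monomial α.1 (1 : F))

theorem listDeriv_sum_pow_mem_polyFun {F ι' : Type*} [Field F] {N N₀ D E s : ℕ}
    {g : Fin s → (ι' → F) → MvPolynomial (Fin N) F}
    (hg : ∀ i, g i ∈ polyFun ι' F (MvPolynomial (Fin N) F) D) (l : List (Fin N)) (c : Fin s → F)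
    (L : Fin N → MvPolynomial (Fin N₀) F) :
    (fun a => proj L (listDeriv l (∑ i, C (c i) * g i a ^ E))) ∈
      polyFun ι' F (MvPolynomial (Fin N₀) F) (D * E) := by
  refine map_mem_polyFun ((proj L).toLinearMap ∘ₗ listDeriv l)
    (sum_mem_polyFun _ fun i _ => ?_)
  simp only [← smul_eq_C_mul]
  exact map_mem_polyFun (c i • LinearMap.id) (pow_mem_polyFun (hg i) E)

theorem card_index_le {s N r M m R : ℕ} (hN : 1 ≤ M) (hNM : N ≤ M) (hr : r ≤ R) :
    Fintype.card (Fin s × Mon N r) * m ≤ s * M ^ R * m := by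
  rw [Fintype.card_prod, Fintype.card_fin]
  gcongr
  exact (card_mon_le N r).trans ((Nat.pow_le_pow_left hNM r).trans (Nat.pow_le_pow_right hN hr))

/-- The probability that a random circuit is non-degenerate, under explicit numerical hypotheses. -/
theorem one_sub_le_uniformProb_isNonDegenerate {F : Type*} [Field F] {n s t m B q A κ b : ℕ}
    (ht : 1 ≤ t) (hk : 2 * derOrder n s t ≤ m)
    (hB : s ≤ B ^ derOrder n s t)
    (hN₁ : zVars n t + derOrder n s t * B * Fintype.card (Mon (zVars n t) (t - 1)) ≤ n)
    (hN₂ : wVars n t + derOrder n s t * B * Fintype.card (Mon (wVars n t) (t - 1)) ≤ zVars n t)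
    (hq : q.Prime) (hA : 0 < A) (hAq : A ≤ q) (hs : s ≤ q ^ κ) (hAqm : A * q + 1 ≤ wVars n t)
    (hbA : b * A ≤ t * (m - 2 * derOrder n s t))
    (hb : 2 * derOrder n s t * (t - 1) < b * (A - κ))
    (hF : ∀ j, 1 ≤ j → j ≤ 2 * (t * m) → (j : F) ≠ 0)
    (S : Finset F) (hS : S.Nonempty) (c : Fin s → F) (hc : ∀ i, c i ≠ 0) :
    1 - ((4 * (s * zVars n t ^ (2 * derOrder n s t * t) * m) : ℕ) : ℝ) / S.card ≤
      uniformProb (fun a : Fin s → Mon n t → S =>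
        IsNonDegenerate n s t m c (fun i => form (fun α => (a i α : F)))) := by
  classical
  simp only [IsNonDegenerate]
  generalize derOrder n s t = k at *
  generalize zVars n t = n₀ at *
  generalize wVars n t = m₀ at *
  have hm₀n₀ : m₀ ≤ n₀ := by omega
  have hn₀n : n₀ ≤ n := by omega
  set e := m - k with he
  have hdeg : 2 * k * (t - 1) + t * k ≤ t * m + t * k := by
    have h1 : 2 * k * (t - 1) ≤ 2 * k * t := Nat.mul_le_mul_left _ (by omega)
    have h2 : 2 * k * t ≤ m * t := Nat.mul_le_mul_right _ hk
    have h3 : m * t = t * m := Nat.mul_comm _ _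
    omega
  have htk : k * (t - 1) ≤ 2 * k * (t - 1) := by
    rw [mul_assoc, two_mul]
    exact Nat.le_add_right _ _
  obtain ⟨w, hw⟩ := exists_code (s := s) hq hAq hs
  obtain ⟨φz, hφz⟩ := exists_embedding_ne_zero (hAqm.trans hm₀n₀)
  obtain ⟨φw, hφw⟩ := exists_embedding_ne_zero hAqm
  -- One independence statement serves all four conditions: `E` is `m - k` or, in condition 2, `m -
  -- 2k`, and `r` is `k(t-1)`, `2k(t-1)` or `0`.
  have hbase : ∀ {N : ℕ} (φ : Fin A × Fin q ↪ Fin N) (r E : ℕ), r ≤ 2 * k * (t - 1) →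
      m - 2 * k ≤ E → E ≤ m → LinearIndependent F fun x : Fin s × Mon N r =>
        monomial x.2.1 1 * (wordForm F φ (w x.1) ^ t) ^ E := by
    intro N φ r E hr hE hEm
    simp only [← pow_mul]
    refine linearIndependent_wordForm hA φ w hw (hbA.trans (Nat.mul_le_mul_left _ hE))
      (hr.trans_lt hb) fun j hj hj' => hF j hj ?_
    have h1 : t * E ≤ t * m := Nat.mul_le_mul_left _ hEm
    omega
  have hhom : ∀ {N : ℕ} (φ : Fin A × Fin q ↪ Fin N) (i : Fin s),
      (wordForm F φ (w i) ^ t).IsHomogeneous t := fun φ i => by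
    simpa using (wordForm_isHomogeneous (F := F) φ (w i)).pow t
  have hfact : ∀ E, E ≤ m → k ≤ E → (E.descFactorial k : F) ≠ 0 := by
    intro E hE hkE
    rw [Nat.descFactorial_eq_prod_range, Nat.cast_prod, Finset.prod_ne_zero_iff]
    intro j hj
    rw [Finset.mem_range] at hj
    refine hF _ (by omega) ?_
    have : m ≤ t * m := Nat.le_mul_of_pos_left m ht
    omega
  obtain ⟨l₁, Q₁, hl₁, hQ₁, hI₁⟩ := exists_linearIndependent_listDeriv ht (by omega : k ≤ m) hN₁ hB
    c hc (hfact m le_rfl (by omega)) _ (hhom φz) (hbase φz _ (m - k) htk (by omega) (by omega))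
  obtain ⟨l₂, H, hl₂, hH, hI₂⟩ := exists_linearIndependent_listDeriv ht (by omega : k ≤ e) hN₂ hB
    (fun _ => (1 : F)) (fun _ => one_ne_zero) (hfact e (by omega) (by omega)) _ (hhom φw)
    (hbase φw _ (e - k) htk (by omega) (by omega))
  let L := restr F n n₀
  let P := restr F n₀ m₀
  let Q : Fin s → (Fin s × Mon n t → F) → MvPolynomial (Fin n) F := fun i a =>
    form fun α => a (i, α)
  have hQ : ∀ i a, (Q i a).IsHomogeneous t := fun i a => form_isHomogeneous _
  have hQmem : ∀ i, Q i ∈ polyFun _ F _ 1 := form_mem_polyFun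
  let coeffs : (Fin s → MvPolynomial (Fin n) F) → Fin s × Mon n t → F := fun R x =>
    coeff x.2.1 (R x.1)
  have hcoeffs : ∀ R : Fin s → MvPolynomial (Fin n) F, (∀ i, (R i).IsHomogeneous t) →
      ∀ i, Q i (coeffs R) = R i := fun R hR i => form_coeff (hR i)
  -- Forms in the `z`-variables, read as forms in the first `x`-variables, are recovered by `L`; so
  -- the `G_i` can be prescribed freely in the witnesses for conditions 2 to 4.
  let ren : MvPolynomial (Fin n₀) F →ₐ[F] MvPolynomial (Fin n) F := rename (Fin.castLE hn₀n)
  have hLren : ∀ p, proj L (ren p) = p := proj_restr_rename hn₀n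
  have hcren : ∀ R : Fin s → MvPolynomial (Fin n₀) F, (∀ i, (R i).IsHomogeneous t) →
      ∀ i, proj L (Q i (coeffs fun i => ren (R i))) = R i := fun R hR i => by
    rw [hcoeffs (fun i => ren (R i)) fun i => (hR i).rename_isHomogeneous]
    exact hLren _
  have hGmem : ∀ i, (fun a => proj L (Q i a)) ∈ polyFun _ F _ 1 := fun i =>
    map_mem_polyFun (proj L).toLinearMap (hQmem i)
  have hGemem : ∀ i, (fun a => proj L (Q i a) ^ e) ∈ polyFun _ F _ m := fun i =>
    polyFun_mono (by omega) (pow_mem_polyFun (hGmem i) e)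
  obtain ⟨p₁, hp₁, hd₁, hE₁⟩ := exists_polynomial_linearIndependent (D := m)
    (fun x a => proj L (listDeriv (l₁ x) (∑ i, C (c i) * Q i a ^ m)))
    (fun x => polyFun_mono (by omega) (listDeriv_sum_pow_mem_polyFun hQmem _ _ _))
    (coeffs Q₁) (by simpa only [hcoeffs Q₁ hQ₁] using hI₁)
  obtain ⟨p₂, hp₂, hd₂, hE₂⟩ := exists_polynomial_linearIndependent (D := m)
    (fun x a => proj P (listDeriv (l₂ x) (∑ i, C (1 : F) * proj L (Q i a) ^ e)))
    (fun x => polyFun_mono (by omega)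
      (listDeriv_sum_pow_mem_polyFun (E := e) hGmem _ (fun _ => 1) _))
    (coeffs fun i => ren (H i)) (by simpa only [hcren H hH] using hI₂)
  obtain ⟨p₃, hp₃, hd₃, hE₃⟩ := exists_polynomial_linearIndependent (D := m)
    (fun (x : Fin s × Mon n₀ (2 * k * (t - 1))) a => monomial x.2.1 1 * proj L (Q x.1 a) ^ e)
    (fun x => map_mem_polyFun (LinearMap.mulLeft F (monomial x.2.1 1)) (hGemem x.1))
    (coeffs fun i => ren (wordForm F φz (w i) ^ t)) (by
      simpa only [hcren _ (hhom φz)] using hbase φz _ e le_rfl (by omega) (by omega))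
  have hkill : LinearIndependent F fun i => killFirst ((wordForm F φz (w i) ^ t) ^ e) := by
    have h := hbase φz 0 e (by omega) (by omega) (by omega)
    have hz : (0 : Fin n₀ →₀ ℕ) ∈ Finset.finsuppAntidiag Finset.univ 0 := by simp
    have h' := h.comp (fun i : Fin s => (i, ⟨0, hz⟩)) (Prod.mk_left_injective _)
    simpa only [map_pow, killFirst_wordForm φz hφz, Function.comp_def, monomial_zero', C_1, one_mul]
      using h'
  obtain ⟨p₄, hp₄, hd₄, hE₄⟩ := exists_polynomial_linearIndependent (D := m)
    (fun (i : Fin s) a => killFirst (proj L (Q i a) ^ e))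
    (fun i => map_mem_polyFun killFirst.toLinearMap (hGemem i))
    (coeffs fun i => ren (wordForm F φz (w i) ^ t)) (by
      simpa only [hcren _ (hhom φz)] using hkill)
  have htot : (p₁ * p₂ * p₃ * p₄).totalDegree ≤ 4 * (s * n₀ ^ (2 * k * t) * m) := by
    have h2kt : 2 * k * (t - 1) ≤ 2 * k * t := Nat.mul_le_mul_left _ (by omega)
    have hn₀ : 1 ≤ n₀ := by omega
    have h1 := totalDegree_mul (p₁ * p₂ * p₃) p₄
    have h2 := totalDegree_mul (p₁ * p₂) p₃
    have h3 := totalDegree_mul p₁ p₂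
    have e1 := hd₁.trans (card_index_le (m := m) hn₀ le_rfl (htk.trans h2kt))
    have e2 := hd₂.trans (card_index_le (m := m) hn₀ hm₀n₀ (htk.trans h2kt))
    have e3 := hd₃.trans (card_index_le (m := m) hn₀ le_rfl h2kt)
    have e4 : p₄.totalDegree ≤ s * n₀ ^ (2 * k * t) * m := by
      refine hd₄.trans ?_
      rw [Fintype.card_fin]
      exact Nat.mul_le_mul_right _ (Nat.le_mul_of_pos_right _ (Nat.pow_pos hn₀))
    omega
  have hfinal := one_sub_le_uniformProb (p₁ * p₂ * p₃ * p₄)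
    (mul_ne_zero (mul_ne_zero (mul_ne_zero hp₁ hp₂) hp₃) hp₄) S hS
    (fun a : Fin s → Mon n t → S => ∃ (L : Fin n → MvPolynomial (Fin n₀) F)
      (P : Fin n₀ → MvPolynomial (Fin m₀) F), IsLinearTuple L ∧ IsLinearTuple P ∧
      (IsDirectSum (app L k (∑ i, C (c i) * form (fun α => (a i α : F)) ^ m))
          (fun i => app L k (form (fun α => (a i α : F)) ^ m)) ∧
        ∀ i, Module.finrank F (app L k (form (fun α => (a i α : F)) ^ m)) =
          (n₀ + k * (t - 1) - 1).choose (k * (t - 1))) ∧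
      (IsDirectSum (app P k (∑ i, proj L (form (fun α => (a i α : F))) ^ e))
          (fun i => app P k (proj L (form (fun α => (a i α : F))) ^ e)) ∧
        ∀ i, Module.finrank F (app P k (proj L (form (fun α => (a i α : F))) ^ e)) =
          (m₀ + k * (t - 1) - 1).choose (k * (t - 1))) ∧
      iSupIndep (fun i => shifts (2 * k * (t - 1)) (proj L (form (fun α => (a i α : F))) ^ e)) ∧
      LinearIndependent F (fun i => killFirst (proj L (form (fun α => (a i α : F))) ^ e))) ?_
  · refine le_trans ?_ hfinal
    gcongr
  · intro a ha
    rw [map_mul, map_mul, map_mul] at ha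
    obtain ⟨ha123, ha4⟩ := mul_ne_zero_iff.1 ha
    obtain ⟨ha12, ha3⟩ := mul_ne_zero_iff.1 ha123
    obtain ⟨ha1, ha2⟩ := mul_ne_zero_iff.1 ha12
    set a' : Fin s × Mon n t → F := fun x => (a x.1 x.2 : F) with ha'
    have hG : ∀ i, (proj L (Q i a')).IsHomogeneous t := fun i => by
      have h := (hQ i a').aeval L restr_isLinearTuple
      rwa [one_mul] at h
    have h2 := isDirectSum_app ht (by omega : k ≤ e) hG restr_isLinearTuple (fun _ => (1 : F)) l₂
      hl₂ (hE₂ a' ha2)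
    simp only [C_1, one_mul] at h2
    exact ⟨L, P, restr_isLinearTuple, restr_isLinearTuple,
      isDirectSum_app ht (by omega : k ≤ m) (fun i => hQ i a') restr_isLinearTuple c l₁ hl₁
        (hE₁ a' ha1), h2,
      iSupIndep_shifts (g := fun i => proj L (Q i a') ^ e) (hE₃ a' ha3), hE₄ a' ha4⟩

end PowerSums

namespace PowerSums

/-! ### Numerical choice of the parameters. -/

section Parameters

open Real

/-- Consequences of the bound on `t` in terms of `d`. -/
theorem bounds_of_le_sqrt {d t : ℕ} (ht : 2 ≤ t)
    (h : (t : ℝ) ≤ √(logb 2 (d : ℝ) / (10 * logb 2 (logb 2 (d : ℝ))))) :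
    10 * (t : ℝ) ^ 2 * logb 2 (logb 2 (d : ℝ)) ≤ logb 2 (d : ℝ) ∧ 5 * (t : ℝ) ^ 2 ≤ logb 2 (d : ℝ) ∧
      1000000 ≤ d ∧ 1000 * t ≤ d := by
  have ht' : (2 : ℝ) ≤ t := by exact_mod_cast ht
  rw [Real.le_sqrt' (by linarith)] at h
  set y := logb 2 (d : ℝ) with hy
  have hy0 : 0 ≤ y := by
    rcases Nat.eq_zero_or_pos d with rfl | hd
    · simp [hy]
    · exact logb_nonneg one_lt_two (by exact_mod_cast hd)
  -- Otherwise the quotient under the root is nonpositive (zero when the denominator vanishes),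
  -- contradicting `t ≥ 2`.
  have hly : 0 < logb 2 y := by
    by_contra! hle
    have := div_nonpos_of_nonneg_of_nonpos hy0 (by linarith : 10 * logb 2 y ≤ 0)
    nlinarith
  have hy1 : 1 < y := by
    by_contra! hle
    exact absurd (logb_nonpos one_lt_two hy0 hle) (not_le.2 hly)
  have hmain : 10 * (t : ℝ) ^ 2 * logb 2 y ≤ y := by
    rw [le_div_iff₀ (by positivity)] at h
    linarith
  have hd0 : (0 : ℝ) < d := by
    rcases Nat.eq_zero_or_pos d with rfl | hd
    · simp [hy] at hy1
      linarith
    · exact_mod_cast hd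
  have hdy : (2 : ℝ) ^ y = d := rpow_logb two_pos (by norm_num) hd0
  have hd3 : 3 ≤ d := by
    have h1 : (2 : ℝ) < d := by
      rw [← hdy]
      calc (2 : ℝ) = 2 ^ (1 : ℝ) := by simp
        _ < 2 ^ y := rpow_lt_rpow_of_exponent_lt one_lt_two hy1
    exact_mod_cast h1
  have hy32 : 3 / 2 ≤ y := by
    have h1 : logb 2 ((2 : ℝ) ^ 3) ≤ logb 2 ((d : ℝ) ^ 2) := by
      refine logb_le_logb_of_le one_lt_two (by norm_num) ?_
      have : (3 : ℝ) ≤ d := by exact_mod_cast hd3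
      nlinarith
    rw [logb_pow, logb_pow, logb_self_eq_one one_lt_two] at h1
    push_cast at h1
    linarith
  have hly2 : 1 / 2 ≤ logb 2 y := by
    have h1 : logb 2 (2 : ℝ) ≤ logb 2 (y ^ 2) :=
      logb_le_logb_of_le one_lt_two (by norm_num) (by nlinarith)
    rw [logb_pow, logb_self_eq_one one_lt_two] at h1
    push_cast at h1
    linarith
  have h5 : 5 * (t : ℝ) ^ 2 ≤ y := by nlinarith [sq_nonneg (t : ℝ)]
  have hy20 : 20 ≤ y := by nlinarith
  have hd6 : 1000000 ≤ d := by
    have h1 : (1000000 : ℝ) ≤ d := by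
      rw [← hdy]
      calc (1000000 : ℝ) ≤ 2 ^ (20 : ℕ) := by norm_num
        _ = 2 ^ (20 : ℝ) := by rw [← rpow_natCast]; norm_num
        _ ≤ 2 ^ y := rpow_le_rpow_of_exponent_le one_le_two hy20
    exact_mod_cast h1
  have hyd : y ≤ d := by
    have h1 : (d : ℝ) ≤ 2 ^ (d : ℝ) := by
      rw [rpow_natCast]
      exact_mod_cast Nat.lt_two_pow_self.le
    rw [← hdy] at h1
    have := (rpow_le_rpow_left_iff one_lt_two).1 h1
    rwa [hdy] at this
  refine ⟨hmain, h5, hd6, ?_⟩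
  have h6 : (1000000 : ℝ) ≤ d := by exact_mod_cast hd6
  have h7 : (1000 : ℝ) * t ≤ d := by
    refine abs_le_of_sq_le_sq' ?_ hd0.le |>.2
    nlinarith
  exact_mod_cast h7

/-- The number `n^{1/(30t²)}` is large. -/
theorem twenty_le_logb_div {n d t : ℕ} (hn : (120 * 2 ^ 30 : ℝ) ≤ logb 2 (n : ℝ)) (hdn : d ^ 2 ≤ n)
    (ht : 2 ≤ t) (hd : 1000000 ≤ d)
    (h10 : 10 * (t : ℝ) ^ 2 * logb 2 (logb 2 (d : ℝ)) ≤ logb 2 (d : ℝ))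
    (h5 : 5 * (t : ℝ) ^ 2 ≤ logb 2 (d : ℝ)) :
    20 ≤ logb 2 (n : ℝ) / (30 * (t : ℝ) ^ 2) := by
  have ht' : (0 : ℝ) < t := by exact_mod_cast (by omega : 0 < t)
  have hd0 : (0 : ℝ) < d := by exact_mod_cast (by omega : 0 < d)
  rw [le_div_iff₀ (by positivity)]
  have hν : 2 * logb 2 (d : ℝ) ≤ logb 2 (n : ℝ) := by
    have h1 : logb 2 ((d : ℝ) ^ 2) ≤ logb 2 (n : ℝ) :=
      logb_le_logb_of_le one_lt_two (by positivity) (by exact_mod_cast hdn)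
    rw [logb_pow] at h1
    exact_mod_cast h1
  have hy0 : 0 < logb 2 (d : ℝ) := lt_of_lt_of_le (by positivity) h5
  -- The goal is `600 t² ≤ log n`. If `log log d ≥ 30`, then `log n ≥ 2 log d ≥ 600 t²`; otherwise
  -- `5 t² ≤ log d < 2^30`, which explains the threshold `120 * 2^30`.
  rcases le_or_gt 30 (logb 2 (logb 2 (d : ℝ))) with h | h
  · nlinarith [sq_nonneg (t : ℝ)]
  · have h1 : logb 2 (d : ℝ) < 2 ^ (30 : ℝ) := (logb_lt_iff_lt_rpow one_lt_two hy0).1 h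
    have h2 : (2 : ℝ) ^ (30 : ℝ) = 2 ^ 30 := by rw [← rpow_natCast]; norm_num
    rw [h2] at h1
    linarith

/-- Replacing `X` by an integer that is at least its square root costs a factor two in the exponent.
-/
theorem le_pow_of_rpow_eq {X κ₀ : ℝ} {s z j : ℕ} (hX : 1 ≤ X) (hs : X ^ κ₀ = s)
    (hz : X ≤ (z : ℝ) ^ 2) (hj : 2 * κ₀ ≤ j) : s ≤ z ^ j := by
  have h : (s : ℝ) ≤ (z : ℝ) ^ j := by
    rw [← hs]
    calc X ^ κ₀ ≤ X ^ ((j : ℝ) / 2) := rpow_le_rpow_of_exponent_le hX (by linarith)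
      _ ≤ ((z : ℝ) ^ 2) ^ ((j : ℝ) / 2) := rpow_le_rpow (by linarith) hz (by positivity)
      _ = (z : ℝ) ^ j := by
        rw [← rpow_natCast, ← rpow_natCast, ← rpow_mul (by positivity)]
        congr 1
        push_cast
        ring
  exact_mod_cast h

/-- The numerical constraints on a code of length `A`. -/
theorem exists_code_parameters {d t m k q κ : ℕ} (hd : 1000000 ≤ d) (ht : 1000 * t ≤ d)
    (htm : t * m = d) (hq : 4 * κ ≤ q) (hq0 : 0 < q) (hk : 110 * (t * k) ≤ 13 * d + 110 * t)
    (hκ : 110 * κ ≤ 6 * d + 110) :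
    ∃ A b, 0 < A ∧ A ≤ q ∧ b * A ≤ t * (m - 2 * k) ∧ 2 * k * (t - 1) < b * (A - κ) := by
  have hD : t * (m - 2 * k) = d - 2 * (t * k) := by
    rw [Nat.mul_sub, htm]
    congr 1
    ring
  have hkt : 2 * k * (t - 1) ≤ 2 * (t * k) := by
    calc 2 * k * (t - 1) ≤ 2 * k * t := Nat.mul_le_mul_left _ (by omega)
      _ = 2 * (t * k) := by ring
  rw [hD]
  set D := d - 2 * (t * k)
  have hD0 : 4 * κ ≤ D := by omega
  -- Rounding gives `b * A > D / 2`, and `4κ ≤ A` gives `b * (A - κ) > 3D / 8`, which exceeds `2tk`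
  -- because `tk` is at most about `13d / 110`.
  refine ⟨min q D, D / min q D, by omega, min_le_left _ _, Nat.div_mul_le_self _ _, ?_⟩
  have hA : 4 * κ ≤ min q D := le_min hq hD0
  have hAD : min q D ≤ D := min_le_right _ _
  have hA0 : 0 < min q D := by omega
  generalize min q D = A at *
  have hb : 1 ≤ D / A := (Nat.one_le_div_iff hA0).2 hAD
  have hlt : D < A * (D / A + 1) := Nat.lt_mul_div_succ D hA0
  generalize D / A = b at *
  have h1 : A * (b + 1) ≤ 2 * (b * A) := by nlinarith
  have h2 : 3 * (b * A) ≤ 4 * (b * (A - κ)) := by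
    have : b * (3 * A) ≤ b * (4 * (A - κ)) := Nat.mul_le_mul_left _ (by omega)
    calc 3 * (b * A) = b * (3 * A) := by ring
      _ ≤ b * (4 * (A - κ)) := this
      _ = _ := by ring
  omega

theorem add_mul_card_le {x t N₀ N k u v : ℕ} (hx : 2 ≤ x) (hk : k ≤ x) (hN₀ : N₀ ≤ x ^ u)
    (hu : u + 1 ≤ v) (hv : 1 + t + u * (t - 1) + 1 ≤ v) (hN : x ^ v ≤ N) :
    N₀ + k * x ^ t * Fintype.card (Mon N₀ (t - 1)) ≤ N := by
  obtain ⟨v, rfl⟩ : ∃ v', v = v' + 1 := ⟨v - 1, by omega⟩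
  have h1 : N₀ ≤ x ^ v := hN₀.trans (Nat.pow_le_pow_right (by omega) (by omega))
  have h2 : k * x ^ t * Fintype.card (Mon N₀ (t - 1)) ≤ x ^ v := by
    calc k * x ^ t * Fintype.card (Mon N₀ (t - 1)) ≤ x * x ^ t * (x ^ u) ^ (t - 1) := by
          gcongr
          exact (card_mon_le _ _).trans (Nat.pow_le_pow_left hN₀ _)
      _ = x ^ (1 + t + u * (t - 1)) := by rw [← pow_mul]; ring
      _ ≤ x ^ v := Nat.pow_le_pow_right (by omega) (by omega)
  have h3 : 2 * x ^ v ≤ x ^ (v + 1) := by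
    rw [pow_succ, mul_comm]
    exact Nat.mul_le_mul_left _ hx
  omega

/-- The parameters in terms of the scale `X = n^{1/(30t²)}` and the exponent `κ₀` with
`s = X^κ₀`. -/
theorem exists_scale {n d s t : ℕ} (hn : (120 * 2 ^ 30 : ℝ) ≤ logb 2 (n : ℝ))
    (hdn : d ^ 2 ≤ n) (ht : 2 ≤ t)
    (htd : (t : ℝ) ≤ √(logb 2 (d : ℝ) / (10 * logb 2 (logb 2 (d : ℝ))))) (hs : 1 ≤ s)
    (hs₁ : (s : ℝ) ≤ (n : ℝ) ^ ((d : ℝ) / (1100 * (t : ℝ) ^ 2)))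
    (hs₂ : (s : ℝ) ≤ (2 : ℝ) ^ ((n : ℝ) ^ ((1 : ℝ) / (30 * (t : ℝ) ^ 2)))) :
    ∃ X κ₀ : ℝ, 1048576 ≤ X ∧ 0 ≤ κ₀ ∧ 20 * κ₀ ≤ X ∧ 110 * κ₀ ≤ 3 * d ∧ X ^ κ₀ = s ∧
      X ^ (30 * t ^ 2) = n ∧ zVars n t = ⌊X ^ (10 * t)⌋₊ ∧ wVars n t = ⌊X ^ 2⌋₊ ∧
      13 * κ₀ ≤ 3 * (t * derOrder n s t : ℝ) ∧
      3 * (t * derOrder n s t : ℝ) < 13 * κ₀ + 3 * t ∧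
      n ^ derOrder n s t ≤ n * s ^ (130 * t) := by
  obtain ⟨h10, h5, hd6, -⟩ := bounds_of_le_sqrt ht htd
  have h20 := twenty_le_logb_div hn hdn ht hd6 h10 h5
  have ht' : (2 : ℝ) ≤ t := by exact_mod_cast ht
  have hdn' : d ≤ n := le_trans (by nlinarith) hdn
  have hn0 : (0 : ℝ) < n := by exact_mod_cast (by omega : 0 < n)
  have hs0 : (0 : ℝ) < s := by exact_mod_cast hs
  set ν := logb 2 (n : ℝ) with hν
  set σ := logb 2 (s : ℝ) with hσ
  set X := (n : ℝ) ^ ((1 : ℝ) / (30 * (t : ℝ) ^ 2)) with hX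
  set lX := ν / (30 * (t : ℝ) ^ 2) with hlX
  have hνlX : ν = 30 * (t : ℝ) ^ 2 * lX := by rw [hlX]; field_simp
  have hX2 : X = 2 ^ lX := by
    rw [hX, hlX, ← rpow_logb two_pos (by norm_num) hn0, ← rpow_mul two_pos.le, ← hν]
    congr 1
    ring
  have hX0 : 0 < X := by rw [hX2]; positivity
  have hX20 : 1048576 ≤ X := by
    rw [hX2]
    calc (1048576 : ℝ) = 2 ^ (20 : ℝ) := by
          rw [show (20 : ℝ) = ((20 : ℕ) : ℝ) by norm_num, rpow_natCast]; norm_num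
      _ ≤ 2 ^ lX := rpow_le_rpow_of_exponent_le one_le_two h20
  have hσ0 : 0 ≤ σ := logb_nonneg one_lt_two (by exact_mod_cast hs)
  have hσX : σ ≤ X := (logb_le_iff_le_rpow one_lt_two hs0).2 hs₂
  have hσd : σ ≤ d / (1100 * (t : ℝ) ^ 2) * ν := by
    rw [hν, ← logb_rpow_eq_mul_logb_of_pos hn0]
    exact logb_le_logb_of_le one_lt_two hs0 hs₁
  -- `κ₀` is the logarithm of `s` to base `X`. The two bounds on `s` become `20 κ₀ ≤ X` and `110 κ₀
  -- ≤ 3d`.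
  set κ₀ := σ / lX with hκ₀
  have hlX0 : 0 < lX := by linarith
  have hσκ : σ = κ₀ * lX := by rw [hκ₀]; field_simp
  have hκ₀0 : 0 ≤ κ₀ := by positivity
  have hκX : 20 * κ₀ ≤ X := by nlinarith
  have hκd : 110 * κ₀ ≤ 3 * d := by
    have h1 : d / (1100 * (t : ℝ) ^ 2) * ν = 3 / 110 * d * lX := by
      rw [hνlX]
      field_simp
      ring
    rw [h1, hσκ] at hσd
    have := le_of_mul_le_mul_right hσd hlX0
    linarith
  have hsX : X ^ κ₀ = s := by
    rw [hX2, ← rpow_mul two_pos.le, mul_comm, ← hσκ]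
    exact rpow_logb two_pos (by norm_num) hs0
  -- powers of `X`
  have hXn : X ^ (30 * t ^ 2) = n := by
    rw [hX, ← rpow_natCast, ← rpow_mul hn0.le]
    push_cast
    rw [one_div, inv_mul_cancel₀ (by positivity), rpow_one]
  have hXz : zVars n t = ⌊X ^ (10 * t)⌋₊ := by
    rw [zVars, hX, ← rpow_natCast, ← rpow_mul hn0.le]
    congr 2
    push_cast
    field_simp
    ring
  have hXw : wVars n t = ⌊X ^ 2⌋₊ := by
    rw [wVars, hX, ← rpow_mul_natCast hn0.le]
    congr 2
    push_cast
    field_simp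
    ring
  -- the order of the derivatives
  have hkdef : 130 * (t : ℝ) * σ / ν = 13 * κ₀ / (3 * t) := by
    rw [hσκ, hνlX]
    field_simp
    ring
  have hk1 : 13 * κ₀ ≤ 3 * (t * derOrder n s t : ℝ) := by
    have h1 : 13 * κ₀ / (3 * t) ≤ derOrder n s t := by
      rw [← hkdef]
      exact Nat.le_ceil _
    rw [div_le_iff₀ (by positivity)] at h1
    linarith
  have hk2' : (derOrder n s t : ℝ) < 13 * κ₀ / (3 * t) + 1 := by
    rw [← hkdef]
    exact Nat.ceil_lt_add_one (by rw [hkdef]; positivity)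
  have hk2 : 3 * (t * derOrder n s t : ℝ) < 13 * κ₀ + 3 * t := by
    rw [← sub_lt_iff_lt_add, lt_div_iff₀ (by positivity)] at hk2'
    linarith
  have hkν : derOrder n s t * ν ≤ ν + 130 * t * σ := by
    have hν0 : 0 < ν := by rw [hνlX]; positivity
    have h1 : (derOrder n s t : ℝ) < 130 * t * σ / ν + 1 := by rw [hkdef]; exact hk2'
    rw [← sub_lt_iff_lt_add, lt_div_iff₀ hν0] at h1
    linarith
  refine ⟨X, κ₀, hX20, hκ₀0, hκX, hκd, hsX, hXn, hXz, hXw, hk1, hk2, ?_⟩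
  have h1 : (n : ℝ) ^ derOrder n s t ≤ n * (s : ℝ) ^ (130 * t) := by
    rw [← logb_le_logb one_lt_two (by positivity) (by positivity), logb_pow,
      logb_mul (by positivity) (by positivity), logb_pow]
    push_cast
    exact hkν
  exact_mod_cast h1

/-- Since `n₀ ^ (2kt) ≤ n ^ k ≤ n * s ^ (130t)`, the size `(ns) ^ (150t)` exceeds the total degree
by a factor `n`. -/
theorem degree_mul_le {n s t m k n₀ : ℕ} (ht : 1 ≤ t) (hnk : n ^ k ≤ n * s ^ (130 * t))
    (hz : n₀ ^ (3 * t) ≤ n) (hn₀ : 0 < n₀) (hmn : m ≤ n) (hn : 4 ≤ n) (hs : 1 ≤ s) :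
    4 * (s * n₀ ^ (2 * k * t) * m) * n ≤ (n * s) ^ (150 * t) := by
  have h1 : n₀ ^ (2 * k * t) ≤ n * s ^ (130 * t) := by
    calc n₀ ^ (2 * k * t) ≤ n₀ ^ (3 * t * k) := by
          refine Nat.pow_le_pow_right hn₀ ?_
          nlinarith [Nat.zero_le (k * t)]
      _ = (n₀ ^ (3 * t)) ^ k := pow_mul _ _ _
      _ ≤ n ^ k := Nat.pow_le_pow_left hz _
      _ ≤ _ := hnk
  calc 4 * (s * n₀ ^ (2 * k * t) * m) * n ≤ n * (s * (n * s ^ (130 * t)) * n) * n :=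
        Nat.mul_le_mul_right _ (Nat.mul_le_mul hn (Nat.mul_le_mul (Nat.mul_le_mul_left _ h1) hmn))
    _ = n ^ 4 * s ^ (130 * t + 1) := by ring
    _ ≤ n ^ (150 * t) * s ^ (150 * t) :=
        Nat.mul_le_mul (Nat.pow_le_pow_right (by omega) (by omega))
          (Nat.pow_le_pow_right hs (by omega))
    _ = (n * s) ^ (150 * t) := (mul_pow _ _ _).symm

theorem exponent_le {t : ℕ} (ht : 2 ≤ t) :
    20 * t + 1 ≤ 30 * t ^ 2 ∧ 1 + t + 20 * t * (t - 1) + 1 ≤ 30 * t ^ 2 := by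
  obtain ⟨t, rfl⟩ : ∃ t', t = t' + 1 := ⟨t - 1, by omega⟩
  rw [Nat.add_sub_cancel]
  constructor <;> nlinarith

theorem mul_add_one_le {A q x : ℕ} (hA : A ≤ q) (hq : q + 1 ≤ x) : A * q + 1 ≤ x ^ 2 := by
  calc A * q + 1 ≤ (q + 1) * (q + 1) := by nlinarith
    _ ≤ x * x := Nat.mul_le_mul hq hq
    _ = x ^ 2 := (sq x).symm

theorem exists_parameters_of_scale {n d s t m k n₀ m₀ : ℕ} {X κ₀ : ℝ} (ht : 2 ≤ t)
    (hd6 : 1000000 ≤ d) (htd' : 1000 * t ≤ d) (hdn : d ^ 2 ≤ n) (htm : t * m = d) (hs : 1 ≤ s)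
    (hX20 : 1048576 ≤ X) (hκ₀0 : 0 ≤ κ₀) (hκX : 20 * κ₀ ≤ X) (hκd : 110 * κ₀ ≤ 3 * d)
    (hsX : X ^ κ₀ = s) (hXn : X ^ (30 * t ^ 2) = n) (hXz : n₀ = ⌊X ^ (10 * t)⌋₊)
    (hXw : m₀ = ⌊X ^ 2⌋₊) (hk1 : 13 * κ₀ ≤ 3 * (t * k : ℝ))
    (hk2 : 3 * (t * k : ℝ) < 13 * κ₀ + 3 * t) (hnk : n ^ k ≤ n * s ^ (130 * t)) :
    ∃ B q A κ b, 2 * k ≤ m ∧ s ≤ B ^ k ∧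
      n₀ + k * B * Fintype.card (Mon n₀ (t - 1)) ≤ n ∧
      m₀ + k * B * Fintype.card (Mon m₀ (t - 1)) ≤ n₀ ∧
      q.Prime ∧ 0 < A ∧ A ≤ q ∧ s ≤ q ^ κ ∧ A * q + 1 ≤ m₀ ∧ b * A ≤ t * (m - 2 * k) ∧
      2 * k * (t - 1) < b * (A - κ) ∧
      4 * (s * n₀ ^ (2 * k * t) * m) * n ≤ (n * s) ^ (150 * t) := by
  have ht' : (2 : ℝ) ≤ t := by exact_mod_cast ht
  have hX0 : 0 < X := by linarith
  have hdn' : d ≤ n := le_trans (by nlinarith) hdn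
  set x := ⌊X⌋₊ with hx
  have hxX : (x : ℝ) ≤ X := Nat.floor_le hX0.le
  have hXx : X < x + 1 := Nat.lt_floor_add_one X
  have hx20 : 1048576 ≤ x := Nat.le_floor (by exact_mod_cast hX20)
  have hx2 : x + 1 ≤ x ^ 2 := by nlinarith
  have hn₁ : x ^ (30 * t ^ 2) ≤ n := by
    have : (x : ℝ) ^ (30 * t ^ 2) ≤ n := by rw [← hXn]; gcongr
    exact_mod_cast this
  have hz₁ : x ^ (10 * t) ≤ n₀ := by
    rw [hXz]
    exact Nat.le_floor (by push_cast; gcongr)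
  have hw₁ : x ^ 2 ≤ m₀ := by
    rw [hXw]
    exact Nat.le_floor (by push_cast; gcongr)
  have hz₂' : (n₀ : ℝ) ≤ X ^ (10 * t) := by
    rw [hXz]
    exact Nat.floor_le (by positivity)
  have hz₂ : n₀ ≤ x ^ (20 * t) := by
    have h1 : (n₀ : ℝ) ≤ (((x + 1) ^ (10 * t) : ℕ) : ℝ) := by
      push_cast
      exact hz₂'.trans (by gcongr)
    calc n₀ ≤ (x + 1) ^ (10 * t) := by exact_mod_cast h1
      _ ≤ (x ^ 2) ^ (10 * t) := Nat.pow_le_pow_left hx2 _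
      _ = x ^ (20 * t) := by rw [← pow_mul]; ring
  have hw₂ : m₀ ≤ x ^ 4 := by
    have h1 : (m₀ : ℝ) ≤ (((x + 1) ^ 2 : ℕ) : ℝ) := by
      rw [hXw]
      push_cast
      exact (Nat.floor_le (by positivity)).trans (by gcongr)
    calc m₀ ≤ (x + 1) ^ 2 := by exact_mod_cast h1
      _ ≤ (x ^ 2) ^ 2 := Nat.pow_le_pow_left hx2 _
      _ = x ^ 4 := by rw [← pow_mul]
  have hxR : (1048576 : ℝ) ≤ x := by exact_mod_cast hx20
  have hkx : k ≤ x := by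
    have h1 : (k : ℝ) ≤ x := by
      by_contra! h
      have h2 : (2 * (k - 1) : ℝ) ≤ t * (k - 1) := mul_le_mul_of_nonneg_right ht' (by linarith)
      linarith
    exact_mod_cast h1
  have hk110 : 110 * (t * k) ≤ 13 * d + 110 * t := by
    have h1 : (110 * (t * k) : ℝ) ≤ 13 * d + 110 * t := by linarith
    exact_mod_cast h1
  have h2k : 2 * k ≤ m := by
    have h1 : t * (2 * k) ≤ t * m := by
      rw [htm, show t * (2 * k) = 2 * (t * k) by ring]
      omega
    exact Nat.le_of_mul_le_mul_left h1 (by omega)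
  -- Bertrand's postulate gives a prime with `x / 2 ≤ q < x`: below `x` so that `A * q + 1 ≤ x ^ 2 ≤
  -- m₀`, yet with `q ^ 2 ≥ X`.
  obtain ⟨q, hq, hMq, hqM⟩ := Nat.exists_prime_lt_and_le_two_mul ((x - 1) / 2) (by omega)
  have hqx : x ≤ 2 * q := by omega
  have hqx' : q + 1 ≤ x := by omega
  have hqR : (x : ℝ) ≤ 2 * q := by exact_mod_cast hqx
  set κ := ⌈2 * κ₀⌉₊ with hκ
  have hκ1 : 2 * κ₀ ≤ κ := Nat.le_ceil _
  have hκ2 : (κ : ℝ) < 2 * κ₀ + 1 := Nat.ceil_lt_add_one (by positivity)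
  have h4κ : 4 * κ ≤ q := by
    have h1 : (4 * κ : ℝ) ≤ q := by linarith
    exact_mod_cast h1
  have hκ110 : 110 * κ ≤ 6 * d + 110 := by
    have h1 : (110 * κ : ℝ) ≤ 6 * d + 110 := by linarith
    exact_mod_cast h1
  obtain ⟨A, b, hA0, hAq, hbA, hb⟩ :=
    exists_code_parameters hd6 htd' htm h4κ hq.pos hk110 hκ110
  -- With `B = x ^ t` the labels number `x ^ (tk)`, enough for `s = X ^ κ₀` because `tk ≥ 13κ₀ / 3 ≥
  -- 2κ₀`.
  refine ⟨x ^ t, q, A, κ, b, h2k, ?_, ?_, ?_, hq, hA0, hAq, ?_, ?_, hbA, hb, ?_⟩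
  · rw [← pow_mul]
    refine le_pow_of_rpow_eq (by linarith) hsX (by nlinarith) ?_
    push_cast
    linarith
  · exact add_mul_card_le (by omega) hkx hz₂ (exponent_le ht).1 (exponent_le ht).2 hn₁
  · exact add_mul_card_le (by omega) hkx hw₂ (by omega) (by omega) hz₁
  · exact le_pow_of_rpow_eq (by linarith) hsX (by nlinarith) hκ1
  · exact (mul_add_one_le hAq hqx').trans hw₁
  · have hz3 : n₀ ^ (3 * t) ≤ n := by
      have h1 : (n₀ : ℝ) ^ (3 * t) ≤ n := by
        rw [← hXn]
        calc (n₀ : ℝ) ^ (3 * t) ≤ (X ^ (10 * t)) ^ (3 * t) := by gcongr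
          _ = X ^ (30 * t ^ 2) := by rw [← pow_mul]; ring
      exact_mod_cast h1
    exact degree_mul_le (by omega) hnk hz3 (lt_of_lt_of_le (by positivity) hz₁)
      (le_trans (by rw [← htm]; exact Nat.le_mul_of_pos_left m (by omega)) hdn') (by omega) hs

theorem exists_parameters {n d s t m : ℕ} (hn : (120 * 2 ^ 30 : ℝ) ≤ logb 2 (n : ℝ))
    (hdn : d ^ 2 ≤ n) (ht : 2 ≤ t)
    (htd : (t : ℝ) ≤ √(logb 2 (d : ℝ) / (10 * logb 2 (logb 2 (d : ℝ))))) (hs : 1 ≤ s)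
    (hs₁ : (s : ℝ) ≤ (n : ℝ) ^ ((d : ℝ) / (1100 * (t : ℝ) ^ 2)))
    (hs₂ : (s : ℝ) ≤ (2 : ℝ) ^ ((n : ℝ) ^ ((1 : ℝ) / (30 * (t : ℝ) ^ 2))))
    (htm : t * m = d) :
    ∃ B q A κ b, 2 * derOrder n s t ≤ m ∧ s ≤ B ^ derOrder n s t ∧
      zVars n t + derOrder n s t * B * Fintype.card (Mon (zVars n t) (t - 1)) ≤ n ∧
      wVars n t + derOrder n s t * B * Fintype.card (Mon (wVars n t) (t - 1)) ≤ zVars n t ∧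
      q.Prime ∧ 0 < A ∧ A ≤ q ∧ s ≤ q ^ κ ∧ A * q + 1 ≤ wVars n t ∧ b * A ≤ t * (m - 2 * derOrder n s t) ∧
      2 * derOrder n s t * (t - 1) < b * (A - κ) ∧
      4 * (s * zVars n t ^ (2 * derOrder n s t * t) * m) * n ≤ (n * s) ^ (150 * t) := by
  obtain ⟨-, -, hd6, htd'⟩ := bounds_of_le_sqrt ht htd
  obtain ⟨X, κ₀, h1, h2, h3, h4, h5, h6, h7, h8, h9, h10, h11⟩ :=
    exists_scale hn hdn ht htd hs hs₁ hs₂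
  exact exists_parameters_of_scale ht hd6 htd' hdn htm hs h1 h2 h3 h4 h5 h6 h7 h8 h9 h10 h11

end Parameters

end PowerSums

/-! ### Conclusion. -/

theorem mainTheorem3 :
    ∃ δ : ℕ → ℝ, Filter.Tendsto δ Filter.atTop (nhds 0) ∧
      ∀ (n d s t m : ℕ), d ^ 2 ≤ n → 2 ≤ t →
        (t : ℝ) ≤ Real.sqrt (Real.logb 2 (d : ℝ) /
          (10 * Real.logb 2 (Real.logb 2 (d : ℝ)))) →
        1 ≤ s →
        (s : ℝ) ≤ (n : ℝ) ^ ((d : ℝ) / (1100 * (t : ℝ) ^ 2)) →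
        (s : ℝ) ≤ (2 : ℝ) ^ ((n : ℝ) ^ ((1 : ℝ) / (30 * (t : ℝ) ^ 2))) →
        t * m = d →
        ∀ (F : Type*) [Field F], (ringChar F = 0 ∨ 2 * d < ringChar F) →
        ∀ S : Finset F, (n * s) ^ (150 * t) ≤ S.card →
        ∀ c : Fin s → F, (∀ i, c i ≠ 0) →
          1 - δ n ≤ PowerSums.uniformProb
            (fun a : Fin s → PowerSums.Mon n t → S =>
              PowerSums.IsNonDegenerate n s t m c
                (fun i => PowerSums.form (fun α => (a i α : F)))) := by
  have hlog : Filter.Tendsto (fun n : ℕ => Real.logb 2 (n : ℝ)) Filter.atTop Filter.atTop :=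
    (Real.tendsto_logb_atTop one_lt_two).comp tendsto_natCast_atTop_atTop
  -- Below the threshold the value `1` makes the claim trivial; this affects only finitely many `n`.
  refine ⟨fun n => if (120 * 2 ^ 30 : ℝ) ≤ Real.logb 2 (n : ℝ) then 1 / (n : ℝ) else 1, ?_, ?_⟩
  · refine tendsto_one_div_atTop_nhds_zero_nat.congr' ?_
    filter_upwards [hlog.eventually_ge_atTop (120 * 2 ^ 30 : ℝ)] with n hn
    rw [if_pos hn]
  · intro n d s t m hdn ht htd hs hs₁ hs₂ htm F _ hchar S hS c hc
    by_cases hn : (120 * 2 ^ 30 : ℝ) ≤ Real.logb 2 (n : ℝ)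
    · have hn0 : 0 < n := by
        rcases Nat.eq_zero_or_pos n with rfl | h
        · norm_num at hn
        · exact h
      obtain ⟨B, q, A, κ, b, h2k, hB, hN₁, hN₂, hq, hA, hAq, hsq, hAqm, hbA, hb, hdeg⟩ :=
        PowerSums.exists_parameters hn hdn ht htd hs hs₁ hs₂ htm
      have hScard : 0 < S.card := lt_of_lt_of_le (by positivity) hS
      have hF : ∀ j, 1 ≤ j → j ≤ 2 * (t * m) → (j : F) ≠ 0 := by
        intro j hj hj' h0
        have hdvd := (ringChar.spec F j).1 h0
        rcases hchar with h | h
        · rw [h, zero_dvd_iff] at hdvd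
          omega
        · have := Nat.le_of_dvd hj hdvd
          omega
      refine le_trans ?_ (PowerSums.one_sub_le_uniformProb_isNonDegenerate (by omega) h2k hB hN₁
        hN₂ hq hA hAq hsq hAqm hbA hb hF S (Finset.card_pos.1 hScard) c hc)
      simp only [if_pos hn]
      refine sub_le_sub_left ?_ 1
      rw [div_le_div_iff₀ (by exact_mod_cast hScard) (by exact_mod_cast hn0), one_mul]
      exact_mod_cast hdeg.trans hS
    · simp only [if_neg hn, sub_self]
      exact div_nonneg (Nat.cast_nonneg _) (Nat.cast_nonneg _)
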